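/- All rings are commutative with $1$. For ideals $I,J$ of a ring $R$ let $\tilde W(I,J)$ be the set of ideals $\mathfrak a$ of $R$ such that $I^n\subseteq \mathfrak a+J$ for some $n\ge 1$. For an $R$-module $M$ and $i\ge 0$ put $$H_i^{I,J}(M)=\varprojlim_{\mathfrak a\in\tilde W(I,J)}\ \varprojlim_{t\in\mathbb N}\operatorname{Tor}_i^R(R/\mathfrak a^t,M),$$ where the transition maps are induced by the projections $R/\mathfrak a^t\to R/\mathfrak b^s$ for $\mathfrak a\subseteq\mathfrak b$ and $s\le t$. If $R\to R'$ is a ring homomorphism and $M$ is an $R'$-module, regarded also as an $R$-module, then $H_i^{I,J}(M)$ (formed over $R$) is an $R'$-module by functoriality in $M$. A topological module is called linearly compact if it is Hausdorff, has a base of neighbourhoods of $0$ consisting of submodules, and every family of cosets of closed submodules with the finite intersection property has non-empty intersection. **Theorem.** Let $R$ be a Noetherian ring, $I,J$ ideals of $R$, $(R',\mathfrak m)$ a Noetherian local ring, and $f:R\to R'$ a ring homomorphism such that the image $f(J)$ is equal to the extended ideal $JR'$. Then for every linearly compact $R'$-module $M$ and every $i\ge 0$ there is an isomorphism of $R'$-modules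 $$H_i^{I,J}(M)\cong H_i^{IR',JR'}(M),$$ where the right-hand side is formed over $R'$. **Corollary.** Let $(R,\mathfrak m)$ be a Noetherian local ring, $I,J$ ideals of $R$, and $\varphi:R\to\hat R$ the canonical map to the $\mathfrak m$-adic completion. Suppose that $\varphi(J)=J\hat R$. Let $M$ be an Artinian $R$-module with its natural $\hat R$-module structure (if $\mathfrak m^n x=0$, then $\hat r\in\hat R$ acts on $x$ as any $r\in R$ with the same class as $\hat r$ in $R/\mathfrak m^n$). Then for every $i\ge 0$ there is an isomorphism of $R$-modules $$H_i^{I,J}(M)\cong H_i^{I\hat R,J\hat R}(M).$$ -/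

import Mathlib

universe u v w

open CategoryTheory CategoryTheory.Limits
open scoped TensorProduct Pointwise

/-- A topological `A`-module `M` is *linearly compact* if it is Hausdorff, the neighbourhoods of
`0` have a base consisting of submodules, and every family of cosets of closed submodules which
has the finite intersection property has a non-empty intersection.

No topology on `A` enters: for a linear group topology on `M`, multiplication by each fixed scalar
is automatically continuous. A topology on `A` for which `A × M → M` is continuous would only
be a further restriction on `M`. -/
structure IsLinearlyCompact (A : Type v) (M : Type w) [CommRing A] [AddCommGroup M] [Module A M]
    [TopologicalSpace M] : Prop where
  isTopologicalAddGroup : IsTopologicalAddGroup M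
  t2Space : T2Space M
  isLinearTopology : IsLinearTopology A M
  nonempty_sInter : ∀ F : Set (Set M),
    (∀ C ∈ F, ∃ (x : M) (N : Submodule A M), IsClosed (N : Set M) ∧ C = x +ᵥ (N : Set M)) →
    (∀ G : Set (Set M), G ⊆ F → G.Finite → (⋂₀ G).Nonempty) →
    (⋂₀ F).Nonempty

namespace PairLocalHomology

noncomputable section

section Tor

variable (R : Type u) [CommRing R] (A : Type v) [CommRing A] [Algebra R A]
  (M : Type w) [AddCommGroup M] [Module R M] [Module A M] [IsScalarTower R A M]

/-- The functor `N ↦ M ⊗[R] N` from `R`-modules to `A`-modules, where `M` is an `A`-module,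
`A` is an `R`-algebra, and `A` acts on the factor `M`. -/
def tensorFunctor : ModuleCat.{u} R ⥤ ModuleCat.{max u w} A where
  obj N := ModuleCat.of A (M ⊗[R] N)
  map f := ModuleCat.ofHom (TensorProduct.AlgebraTensorModule.lTensor A M f.hom)
  map_id N := by
    ext : 1
    exact TensorProduct.AlgebraTensorModule.lTensor_id
  map_comp f g := by
    ext : 1
    exact TensorProduct.AlgebraTensorModule.lTensor_comp _ _

instance : (tensorFunctor R A M).Additive where
  map_add {X Y f g} := by
    ext : 1
    exact map_add (TensorProduct.AlgebraTensorModule.lTensor A M) f.hom g.hom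

/-- `N ↦ Tor_i^R(N, M)`, computed from projective resolutions of the `R`-module `N`, with the
`A`-module structure that it inherits from the `A`-module `M`.
For `A = R` it is the usual `R`-module `Tor_i^R(N, M)`. -/
def torFunctor (i : ℕ) : ModuleCat.{u} R ⥤ ModuleCat.{max u w} A :=
  (tensorFunctor R A M).leftDerived i

end Tor

section LocalHomology

variable (R : Type u) [CommRing R]

/-- The system of all `R / 𝔞 ^ t`, with the canonical projections
`R / 𝔞 ^ t → R / 𝔟 ^ s` for `𝔞 ≤ 𝔟` and `s ≤ t`. -/
def quotPow : Ideal R ⥤ ℕᵒᵖ ⥤ ModuleCat.{u} R where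
  obj a := localCohomology.ringModIdeals (localCohomology.idealPowersDiagram a)
  map {a b} h :=
    { app := fun t => ModuleCat.ofHom <|
        Submodule.mapQ (a ^ t.unop) (b ^ t.unop) LinearMap.id (Ideal.pow_right_mono h.le _)
      naturality := fun s t _ => by
        apply ModuleCat.hom_ext
        apply LinearMap.ext
        intro x
        obtain ⟨y, rfl⟩ := Submodule.Quotient.mk_surjective _ x
        rfl }
  map_id a := by
    ext t : 2
    apply ModuleCat.hom_ext
    apply LinearMap.ext
    intro x
    obtain ⟨y, rfl⟩ := Submodule.Quotient.mk_surjective _ x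
    rfl
  map_comp f g := by
    ext t : 2
    apply ModuleCat.hom_ext
    apply LinearMap.ext
    intro x
    obtain ⟨y, rfl⟩ := Submodule.Quotient.mk_surjective _ x
    rfl

variable (A : Type v) [CommRing A] [Algebra R A]
  (M : Type w) [AddCommGroup M] [Module R M] [Module A M] [IsScalarTower R A M]

instance (A : Type v) [CommRing A] : HasLimitsOfShape ℕᵒᵖ (ModuleCat.{w} A) :=
  ModuleCat.hasLimitsOfShape

/-- The local homology modules `H_i^𝔞(M) = lim_t Tor_i^R(R / 𝔞 ^ t, M)` of `M` with respect to one
ideal `𝔞` of `R`, as a functor of `𝔞`: for `𝔞 ≤ 𝔟` the projections `R / 𝔞 ^ t → R / 𝔟 ^ t` induce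
`H_i^𝔞(M) → H_i^𝔟(M)`. -/
def localHomology (i : ℕ) : Ideal R ⥤ ModuleCat.{max u w} A :=
  quotPow R ⋙ (Functor.whiskeringRight ℕᵒᵖ _ _).obj (torFunctor R A M i) ⋙ lim

variable {R}

/-- The set `W̃(I, J)` of the ideals `𝔞` such that `I ^ n ≤ 𝔞 + J` for some `n ≥ 1`. -/
def idealsOfPair (I J : Ideal R) : Set (Ideal R) :=
  {a | ∃ n : ℕ, 1 ≤ n ∧ I ^ n ≤ a ⊔ J}

instance (I J : Ideal R) :
    HasLimitsOfShape (idealsOfPair I J) (ModuleCat.{max u w} A) := ModuleCat.hasLimitsOfShape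

/-- The inverse system of the `H_i^𝔞(M)`, where `𝔞` runs through `W̃(I, J)`; it has a map
`H_i^𝔞(M) → H_i^𝔟(M)` for `𝔞 ≤ 𝔟`. -/
def localHomologySystem (I J : Ideal R) (i : ℕ) :
    idealsOfPair I J ⥤ ModuleCat.{max u w} A :=
  (Subtype.mono_coe (· ∈ idealsOfPair I J)).functor ⋙ localHomology R A M i

/-- The local homology module with respect to the pair of ideals `(I, J)` of `R`,
`H_i^{I,J}(M) = lim_{𝔞 ∈ W̃(I, J)} H_i^𝔞(M) = lim_{𝔞 ∈ W̃(I, J)} lim_t Tor_i^R(R / 𝔞 ^ t, M)`,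
with the `A`-module structure that it inherits from the `A`-module `M`. -/
def localHomologyPair (I J : Ideal R) (i : ℕ) : ModuleCat.{max u w} A :=
  limit (localHomologySystem A M I J i)

end LocalHomology

section Completion

variable (R : Type u) [CommRing R] [IsLocalRing R] [IsNoetherianRing R]
  (M : Type w) [AddCommGroup M] [Module R M] [IsArtinian R M]

/-- The completion of a local ring in the topology defined by its maximal ideal. -/
abbrev Completion (R : Type u) [CommRing R] [IsLocalRing R] : Type u :=
  AdicCompletion (IsLocalRing.maximalIdeal R) R

theorem exists_evalₐ_eq {R : Type u} [CommRing R] [IsLocalRing R] (a : Completion R) (n : ℕ) :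
    ∃ r : R, AdicCompletion.evalₐ (IsLocalRing.maximalIdeal R) n a = Ideal.Quotient.mk _ r := by
  obtain ⟨r, hr⟩ := Ideal.Quotient.mk_surjective
    (AdicCompletion.evalₐ (IsLocalRing.maximalIdeal R) n a)
  exact ⟨r, hr.symm⟩

theorem evalₐ_eq_of_le {R : Type u} [CommRing R] [IsLocalRing R] (a : Completion R) {k n : ℕ}
    (h : k ≤ n) (r : R)
    (hr : AdicCompletion.evalₐ (IsLocalRing.maximalIdeal R) n a = Ideal.Quotient.mk _ r) :
    AdicCompletion.evalₐ (IsLocalRing.maximalIdeal R) k a = Ideal.Quotient.mk _ r := by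
  obtain ⟨f, rfl⟩ := AdicCompletion.mk_surjective _ _ a
  rw [AdicCompletion.evalₐ_mk] at hr ⊢
  rw [← AdicCompletion.Ideal.mk_eq_mk _ h f, Ideal.Quotient.eq]
  exact Ideal.pow_le_pow_right h (Ideal.Quotient.eq.1 hr)

variable {M} in
/-- Each element of an Artinian module over a Noetherian local ring is killed by a power of the
maximal ideal. -/
theorem exists_pow_smul_eq_zero (x : M) :
    ∃ n : ℕ, ∀ r ∈ IsLocalRing.maximalIdeal R ^ n, r • x = 0 := by
  let m := IsLocalRing.maximalIdeal R
  let f : ℕ →o (Submodule R M)ᵒᵈ :=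
    ⟨fun n => OrderDual.toDual (m ^ n • Submodule.span R {x}), fun a b hab =>
      OrderDual.toDual_le_toDual.2 (Submodule.smul_mono_left (Ideal.pow_le_pow_right hab))⟩
  obtain ⟨n, hn⟩ := IsArtinian.monotone_stabilizes f
  have h1 : m ^ n • Submodule.span R {x} = m ^ (n + 1) • Submodule.span R {x} :=
    hn (n + 1) (Nat.le_succ n)
  have hfg : (m ^ n • Submodule.span R {x}).FG :=
    Submodule.FG.smul (IsNoetherian.noetherian _) (Submodule.fg_span_singleton x)
  have h2 : m ^ n • Submodule.span R {x} = ⊥ := by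
    refine Submodule.eq_bot_of_le_smul_of_le_jacobson_bot m _ hfg ?_
      (IsLocalRing.maximalIdeal_le_jacobson _)
    rw [← Submodule.smul_assoc, smul_eq_mul, ← pow_succ']
    exact h1.le
  refine ⟨n, fun r hr => ?_⟩
  have : r • x ∈ m ^ n • Submodule.span R {x} :=
    Submodule.smul_mem_smul hr (Submodule.mem_span_singleton_self x)
  rwa [h2, Submodule.mem_bot] at this

variable {R M}

/-- The natural action of the completion on an Artinian module: if `x` is killed by the `n`-th
power of the maximal ideal, then `a • x = r • x` for every `r : R` with the same class as `a`
modulo this power (see `completionSMul_eq`). -/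
def completionSMul (a : Completion R) (x : M) : M :=
  (Ideal.Quotient.mk_surjective (AdicCompletion.evalₐ (IsLocalRing.maximalIdeal R)
    (exists_pow_smul_eq_zero R x).choose a)).choose • x

theorem completionSMul_eq (a : Completion R) (x : M) (n : ℕ)
    (hn : ∀ r ∈ IsLocalRing.maximalIdeal R ^ n, r • x = 0) (r : R)
    (hr : AdicCompletion.evalₐ (IsLocalRing.maximalIdeal R) n a = Ideal.Quotient.mk _ r) :
    completionSMul a x = r • x := by
  let k := (exists_pow_smul_eq_zero R x).choose
  have hk : ∀ r ∈ IsLocalRing.maximalIdeal R ^ k, r • x = 0 :=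
    (exists_pow_smul_eq_zero R x).choose_spec
  have hs := (Ideal.Quotient.mk_surjective
    (AdicCompletion.evalₐ (IsLocalRing.maximalIdeal R) k a)).choose_spec
  set s := (Ideal.Quotient.mk_surjective
    (AdicCompletion.evalₐ (IsLocalRing.maximalIdeal R) k a)).choose
  change s • x = r • x
  rw [← sub_eq_zero, ← sub_smul]
  obtain ⟨q, hq⟩ := exists_evalₐ_eq a (max n k)
  have hqn : q - r ∈ IsLocalRing.maximalIdeal R ^ n := by
    rw [← Ideal.Quotient.eq, ← hr]
    exact (evalₐ_eq_of_le a (le_max_left n k) q hq).symm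
  have hqk : q - s ∈ IsLocalRing.maximalIdeal R ^ k := by
    rw [← Ideal.Quotient.eq, hs]
    exact (evalₐ_eq_of_le a (le_max_right n k) q hq).symm
  have : s - r = (q - r) - (q - s) := by ring
  rw [this, sub_smul, hn _ hqn, hk _ hqk, sub_zero]

variable (R M) in
/-- The natural module structure of an Artinian module over a Noetherian local ring `R` over the
completion of `R`. -/
@[reducible]
def completionModule : Module (Completion R) M where
  smul := completionSMul
  one_smul x := by
    obtain ⟨n, hn⟩ := exists_pow_smul_eq_zero R x
    exact (completionSMul_eq 1 x n hn 1 (by simp)).trans (one_smul _ _)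
  mul_smul a b x := by
    obtain ⟨n, hn⟩ := exists_pow_smul_eq_zero R x
    obtain ⟨r, hr⟩ := exists_evalₐ_eq a n
    obtain ⟨s, hs⟩ := exists_evalₐ_eq b n
    change completionSMul (a * b) x = completionSMul a (completionSMul b x)
    rw [completionSMul_eq b x n hn s hs, completionSMul_eq a (s • x) n
      (fun t ht => by rw [smul_comm, hn t ht, smul_zero]) r hr,
      completionSMul_eq (a * b) x n hn (r * s) (by rw [map_mul, map_mul, hr, hs]), mul_smul]
  smul_zero a := smul_zero _
  smul_add a x y := by
    obtain ⟨n, hn⟩ := exists_pow_smul_eq_zero R x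
    obtain ⟨k, hk⟩ := exists_pow_smul_eq_zero R y
    have hn' : ∀ r ∈ IsLocalRing.maximalIdeal R ^ (n + k), r • x = 0 := fun r hr =>
      hn r (Ideal.pow_le_pow_right (Nat.le_add_right n k) hr)
    have hk' : ∀ r ∈ IsLocalRing.maximalIdeal R ^ (n + k), r • y = 0 := fun r hr =>
      hk r (Ideal.pow_le_pow_right (Nat.le_add_left k n) hr)
    obtain ⟨r, hr⟩ := exists_evalₐ_eq a (n + k)
    change completionSMul a (x + y) = completionSMul a x + completionSMul a y
    rw [completionSMul_eq a x _ hn' r hr, completionSMul_eq a y _ hk' r hr,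
      completionSMul_eq a (x + y) (n + k)
        (fun t ht => by rw [smul_add, hn' t ht, hk' t ht, add_zero]) r hr, smul_add]
  add_smul a b x := by
    obtain ⟨n, hn⟩ := exists_pow_smul_eq_zero R x
    obtain ⟨r, hr⟩ := exists_evalₐ_eq a n
    obtain ⟨s, hs⟩ := exists_evalₐ_eq b n
    change completionSMul (a + b) x = completionSMul a x + completionSMul b x
    rw [completionSMul_eq a x n hn r hr, completionSMul_eq b x n hn s hs,
      completionSMul_eq (a + b) x n hn (r + s) (by rw [map_add, map_add, hr, hs]), add_smul]
  zero_smul x := by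
    obtain ⟨n, hn⟩ := exists_pow_smul_eq_zero R x
    exact (completionSMul_eq 0 x n hn 0 (by simp)).trans (zero_smul _ _)

end Completion

end

end PairLocalHomology

/-! Let `x` be a finite system of generators of an ideal `a` of `R`. After extension of scalars the
Koszul complexes on the powers `x ^ t` become the Koszul complexes on the images of these elements,
which generate `a R'`. Over a Noetherian ring they replace resolutions of the quotients by `a ^ t`
at the level of pro-systems: the ideals `(x ^ t)` and `a ^ t` are cofinal, and the homology in each
positive degree is pro-zero (`exists_kills_koszul`). So `Tor_i^R(R/a^t, M)` and
`Tor_i^{R'}(R'/(aR')^t, M)` are both pro-isomorphic to the Koszul homology of `M`. Concretely, the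
base change map between them has pro-zero kernel (`exists_mapH_eq_zero`) and pro-zero cokernel
(`exists_mapH_eq_mapH`).

It remains to match the index sets. Extension sends `W̃(I, J)` to `W̃(IR', JR')`, and contraction
goes back because `f(J) = JR'`. Since `(b ∩ R)R' ⊆ b`, a compatible family over `R'` is determined
by its values at extended ideals (`torLimitEquiv`).

The comparison is carried out with matrices and in finitely many degrees. A complex with pro-zero
homology is not exact, but a chain map or homotopy into it extends by one degree after composition
with a transition map that is zero on the relevant homology; `Kills` records this weak exactness.
Each degree costs one such transition map, hence the bound `N` in `IsHom` and `Htpy`; for `Tor_i`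
chain maps are needed up to degree `i + 1` and homotopies up to degree `i`. For an exact complex the
identity serves as transition map, and the same lemmas give the usual comparison theorem.

For the corollary, the completion is Noetherian because it is a quotient of a power series ring over
`R`. -/

namespace PairLocalHomology

/-! ### Matrix complexes, truncated chain maps and homotopies -/

open Matrix

/-- A chain complex of finite free `A`-modules with `A` in degree `0`, given by its matrices. -/
structure MatCx (A : Type u) [CommRing A] where
  ι : ℕ → Type
  [fintype : ∀ n, Fintype (ι n)]
  [decEq : ∀ n, DecidableEq (ι n)]
  pt : ι 0
  eq_pt : ∀ i, i = pt
  d : ∀ n, Matrix (ι n) (ι (n + 1)) A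
  d_mul_d : ∀ n, d n * d (n + 1) = 0

attribute [instance] MatCx.fintype MatCx.decEq

namespace MatCx

variable {A : Type u} [CommRing A] {B : Type v} [CommRing B]

/-- The ideal `𝔠` for which `A ⧸ 𝔠` is the homology in degree `0`. -/
def aug (C : MatCx A) : Ideal A := Ideal.span (Set.range (C.d 0 C.pt))

/-- The matrices `G n` with `n ≤ N` form a chain map from `C` to `C'` which induces the projection
`A ⧸ C.aug → A ⧸ C'.aug` in degree `0`. -/
structure IsHom (N : ℕ) (C C' : MatCx A) (G : ∀ n, Matrix (C'.ι n) (C.ι n) A) : Prop where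
  aug_le : C.aug ≤ C'.aug
  zero : G 0 C'.pt C.pt - 1 ∈ C'.aug
  comm : ∀ n < N, C'.d n * G (n + 1) = G n * C.d n

/-- The families of matrices `G` and `G'` are chain homotopic in degrees at most `N`. -/
def Htpy (N : ℕ) (C C' : MatCx A) (G G' : ∀ n, Matrix (C'.ι n) (C.ι n) A) : Prop :=
  ∃ h : ∀ n, Matrix (C'.ι (n + 1)) (C.ι n) A, G 0 - G' 0 = C'.d 0 * h 0 ∧
    ∀ n < N, G (n + 1) - G' (n + 1) = C'.d (n + 1) * h (n + 1) + h n * C.d n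

/-- `G` is zero on the homology in degree `n + 1`. -/
def Kills (n : ℕ) (C C' : MatCx A) (G : ∀ n, Matrix (C'.ι n) (C.ι n) A) : Prop :=
  ∀ z, C.d n *ᵥ z = 0 → ∃ w, C'.d (n + 1) *ᵥ w = G (n + 1) *ᵥ z

/-- Exactness in all positive degrees. -/
def Exact (C : MatCx A) : Prop :=
  ∀ n z, C.d n *ᵥ z = 0 → ∃ w, C.d (n + 1) *ᵥ w = z

/-- The degreewise product of families of matrices. -/
def comp {C C' C'' : MatCx A} (G : ∀ n, Matrix (C''.ι n) (C'.ι n) A)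
    (F : ∀ n, Matrix (C'.ι n) (C.ι n) A) (n : ℕ) : Matrix (C''.ι n) (C.ι n) A := G n * F n

/-- The identity of a complex. -/
def one (C : MatCx A) (n : ℕ) : Matrix (C.ι n) (C.ι n) A := 1

section Basic

variable {C C' C'' D : MatCx A}

theorem mem_aug {a : A} : a ∈ C.aug ↔ ∃ w, (C.d 0 *ᵥ w) C.pt = a := by
  rw [aug, Ideal.mem_span_range_iff_exists_fun]
  simp only [Matrix.mulVec, dotProduct, mul_comm]

theorem d_zero_mem_aug (i j) : C.d 0 i j ∈ C.aug := by
  rw [C.eq_pt i]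
  exact Ideal.subset_span ⟨j, rfl⟩

theorem exists_mul_eq {l m n : Type*} [Fintype m] (D : Matrix l m A) (X : Matrix l n A)
    (h : ∀ j, ∃ w, D *ᵥ w = X.col j) : ∃ Y : Matrix m n A, D * Y = X := by
  choose w hw using h
  refine ⟨Matrix.of fun i j => w j i, ?_⟩
  ext i j
  exact congrFun (hw j) i

theorem exists_d_zero_mul_eq {n : Type*} (X : Matrix (C.ι 0) n A) (h : ∀ i j, X i j ∈ C.aug) :
    ∃ Y : Matrix (C.ι 1) n A, C.d 0 * Y = X := by
  refine exists_mul_eq _ _ fun j => ?_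
  obtain ⟨w, hw⟩ := mem_aug.1 (h C.pt j)
  refine ⟨w, funext fun i => ?_⟩
  rw [C.eq_pt i, hw]
  rfl

theorem IsHom.mono {M N : ℕ} (h : M ≤ N) {G} (hG : IsHom N C C' G) : IsHom M C C' G :=
  ⟨hG.aug_le, hG.zero, fun n hn => hG.comm n (hn.trans_le h)⟩

theorem isHom_one (N : ℕ) : IsHom N C C C.one :=
  ⟨le_rfl, by simp [one], fun n _ => by simp [one]⟩

theorem Exact.kills (h : C.Exact) (n : ℕ) : Kills n C C C.one := fun z hz => by
  simpa [one] using h n z hz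

theorem IsHom.comp {N : ℕ} {G F} (hG : IsHom N C' C'' G) (hF : IsHom N C C' F) :
    IsHom N C C'' (comp G F) := by
  refine ⟨hF.aug_le.trans hG.aug_le, ?_, fun n hn => ?_⟩
  · have h : MatCx.comp G F 0 C''.pt C.pt = G 0 C''.pt C'.pt * F 0 C'.pt C.pt := by
      rw [MatCx.comp, Matrix.mul_apply]
      exact Fintype.sum_eq_single _ fun i hi => absurd (C'.eq_pt i) hi
    rw [h, show G 0 C''.pt C'.pt * F 0 C'.pt C.pt - 1 = G 0 C''.pt C'.pt * (F 0 C'.pt C.pt - 1)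
      + (G 0 C''.pt C'.pt - 1) by ring]
    exact add_mem (Ideal.mul_mem_left _ _ (hG.aug_le hF.zero)) hG.zero
  · simp only [MatCx.comp]
    rw [← Matrix.mul_assoc, hG.comm n hn, Matrix.mul_assoc, hF.comm n hn, Matrix.mul_assoc]

/-- The start of every lifting argument. Only the inclusion of augmentation ideals is needed up to
degree `1`; from degree `2` on, the homology of the target is an obstruction. -/
theorem exists_isHom_one (h : D.aug ≤ C.aug) : ∃ E, IsHom 1 D C E := by
  let E0 : Matrix (C.ι 0) (D.ι 0) A := Matrix.of fun _ _ => 1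
  obtain ⟨Y, hY⟩ := exists_d_zero_mul_eq (C := C) (E0 * D.d 0) fun i j => by
    rw [Matrix.mul_apply]
    exact sum_mem fun k _ => Ideal.mul_mem_left _ _ (h (d_zero_mem_aug _ _))
  refine ⟨fun n => match n with
    | 0 => E0
    | 1 => Y
    | _ + 2 => 0, h, by simp [E0], fun n hn => ?_⟩
  obtain rfl : n = 0 := by omega
  exact hY

/-- The columns of `E (N + 1) * D.d (N + 1)` are cycles of `C`. They need not be boundaries, but
their images under `G` are, which gives the next component of a lift of `G ∘ E`. -/
theorem IsHom.exists_succ {N : ℕ} {E G} (hE : IsHom (N + 1) D C E) (hG : IsHom (N + 1) C C' G)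
    (hk : Kills N C C' G) : ∃ E', IsHom (N + 2) D C' E' := by
  obtain ⟨Y, hY⟩ := exists_mul_eq (C'.d (N + 1)) (G (N + 1) * E (N + 1) * D.d (N + 1)) fun j => by
    obtain ⟨w, hw⟩ := hk ((E (N + 1) * D.d (N + 1)).col j) (by
      change (C.d N * (E (N + 1) * D.d (N + 1))).col j = 0
      rw [← Matrix.mul_assoc, hE.comm N (by omega), Matrix.mul_assoc, D.d_mul_d, Matrix.mul_zero]
      rfl)
    refine ⟨w, ?_⟩
    rw [hw, Matrix.mul_assoc]
    rfl
  have hGE := hG.comp hE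
  refine ⟨Function.update (MatCx.comp G E) (N + 2) Y, hGE.aug_le, ?_, fun n hn => ?_⟩
  · rw [Function.update_of_ne (by omega)]
    exact hGE.zero
  · rw [Function.update_of_ne (by omega : n ≠ N + 2)]
    obtain rfl | hn' : n = N + 1 ∨ n < N + 1 := by omega
    · rw [Function.update_self, hY]
      rfl
    · rw [Function.update_of_ne (by omega)]
      exact hGE.comm n hn'

theorem Exact.exists_isHom (hC : C.Exact) (h : D.aug ≤ C.aug) (N : ℕ) :
    ∃ E, IsHom N D C E := by
  suffices ∃ E, IsHom (N + 1) D C E from this.imp fun E hE => hE.mono (Nat.le_succ N)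
  induction N with
  | zero => exact exists_isHom_one h
  | succ N ih =>
    obtain ⟨E, hE⟩ := ih
    exact hE.exists_succ (isHom_one _) (hC.kills N)

theorem IsHom.htpy_zero {N : ℕ} {E E'} (hE : IsHom N D C E) (hE' : IsHom N D C E') :
    Htpy 0 D C E E' := by
  obtain ⟨Y, hY⟩ := exists_d_zero_mul_eq (C := C) (E 0 - E' 0) fun i j => by
    rw [C.eq_pt i, D.eq_pt j]
    have := sub_mem hE.zero hE'.zero
    rwa [sub_sub_sub_cancel_right] at this
  refine ⟨fun n => match n with
    | 0 => Y
    | _ + 1 => 0, hY.symm, fun n hn => absurd hn (by omega)⟩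

/-- The defect `X` of the homotopy in degree `N + 1` consists of cycles, and `G` turns these into
boundaries. The new homotopy is `G ∘ h` below that degree and a choice of bounding chains in it. -/
theorem Htpy.exists_succ {N : ℕ} {E E' G} (h : Htpy N D C E E') (hE : IsHom (N + 1) D C E)
    (hE' : IsHom (N + 1) D C E') (hG : IsHom (N + 1) C C' G) (hk : Kills N C C' G) :
    Htpy (N + 1) D C' (comp G E) (comp G E') := by
  obtain ⟨h, h0, h1⟩ := h
  let X := E (N + 1) - E' (N + 1) - h N * D.d N
  have hX : C.d N * X = 0 := by
    have : C.d N * X = (E N - E' N - C.d N * h N) * D.d N := by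
      simp only [X, Matrix.mul_sub, Matrix.sub_mul, hE.comm N (by omega), hE'.comm N (by omega),
        Matrix.mul_assoc]
    rw [this]
    cases N with
    | zero => rw [h0, sub_self, Matrix.zero_mul]
    | succ k => rw [h1 k (by omega), add_sub_cancel_left, Matrix.mul_assoc, D.d_mul_d,
        Matrix.mul_zero]
  obtain ⟨Y, hY⟩ := exists_mul_eq (C'.d (N + 1)) (G (N + 1) * X) fun j =>
    hk (X.col j) (congrArg (fun Z => Matrix.col Z j) hX)
  refine ⟨Function.update (fun n => G (n + 1) * h n) (N + 1) Y, ?_, fun n hn => ?_⟩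
  · rw [Function.update_of_ne (by omega), ← Matrix.mul_assoc, hG.comm 0 (by omega),
      Matrix.mul_assoc, ← h0, Matrix.mul_sub]
    rfl
  · rw [Function.update_of_ne (by omega : n ≠ N + 1)]
    obtain rfl | hn' : n = N ∨ n < N := by omega
    · rw [Function.update_self, hY, Matrix.mul_assoc, ← Matrix.mul_add]
      simp only [comp, X, sub_add_cancel, Matrix.mul_sub]
    · rw [Function.update_of_ne (by omega), ← Matrix.mul_assoc, hG.comm (n + 1) (by omega)]
      simp only [comp, ← Matrix.mul_sub, h1 n hn', Matrix.mul_add, Matrix.mul_assoc]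

theorem one_comp (E : ∀ n, Matrix (C.ι n) (D.ι n) A) : comp C.one E = E :=
  funext fun _ => Matrix.one_mul _

theorem comp_assoc {C''' : MatCx A} (G : ∀ n, Matrix (C'''.ι n) (C''.ι n) A)
    (F : ∀ n, Matrix (C''.ι n) (C'.ι n) A) (E : ∀ n, Matrix (C'.ι n) (C.ι n) A) :
    comp (comp G F) E = comp G (comp F E) :=
  funext fun _ => Matrix.mul_assoc _ _ _

theorem Exact.htpy (hC : C.Exact) {N : ℕ} {E E'} (hE : IsHom N D C E) (hE' : IsHom N D C E') :
    Htpy N D C E E' := by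
  induction N with
  | zero => exact hE.htpy_zero hE'
  | succ N ih =>
    have := (ih (hE.mono (Nat.le_succ N)) (hE'.mono (Nat.le_succ N))).exists_succ hE hE'
      (isHom_one _) (hC.kills N)
    rwa [one_comp, one_comp] at this

theorem Htpy.comp_left {N : ℕ} {E E' G} (h : Htpy N D C E E') (hG : IsHom (N + 1) C C' G) :
    Htpy N D C' (comp G E) (comp G E') := by
  obtain ⟨h, h0, h1⟩ := h
  refine ⟨fun n => G (n + 1) * h n, ?_, fun n hn => ?_⟩
  · rw [← Matrix.mul_assoc, hG.comm 0 (by omega), Matrix.mul_assoc, ← h0, Matrix.mul_sub]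
    rfl
  · rw [← Matrix.mul_assoc, hG.comm (n + 1) (by omega)]
    simp only [comp, ← Matrix.mul_sub, h1 n hn, Matrix.mul_add, Matrix.mul_assoc]

theorem Htpy.trans {N : ℕ} {E E' E''} (h : Htpy N D C E E') (h' : Htpy N D C E' E'') :
    Htpy N D C E E'' := by
  obtain ⟨h, h0, h1⟩ := h
  obtain ⟨k, k0, k1⟩ := h'
  refine ⟨fun n => h n + k n, ?_, fun n hn => ?_⟩
  · rw [Matrix.mul_add, ← h0, ← k0, sub_add_sub_cancel]
  · rw [Matrix.mul_add, Matrix.add_mul, ← sub_add_sub_cancel _ (E' (n + 1)), h1 n hn, k1 n hn]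
    abel

end Basic

/-! ### Extension of scalars -/

section BaseChange

/-- Extension of scalars. -/
def map (f : A →+* B) (C : MatCx A) : MatCx B where
  ι := C.ι
  pt := C.pt
  eq_pt := C.eq_pt
  d n := (C.d n).map f
  d_mul_d n := by rw [← Matrix.map_mul, C.d_mul_d, Matrix.map_zero _ (map_zero f)]

variable {C C' C'' : MatCx A} (f : A →+* B)

/-- Extension of scalars for families of matrices. -/
def mapHom (G : ∀ n, Matrix (C'.ι n) (C.ι n) A) (n : ℕ) :
    Matrix ((C'.map f).ι n) ((C.map f).ι n) B := (G n).map f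

theorem mapHom_comp (G : ∀ n, Matrix (C''.ι n) (C'.ι n) A) (F : ∀ n, Matrix (C'.ι n) (C.ι n) A) :
    mapHom f (comp G F) = comp (mapHom f G) (mapHom f F) :=
  funext fun _ => Matrix.map_mul

theorem aug_map : (C.map f).aug = C.aug.map f := by
  rw [aug, aug, Ideal.map_span, ← Set.range_comp]
  rfl

theorem IsHom.map {N : ℕ} {G} (hG : IsHom N C C' G) :
    IsHom N (C.map f) (C'.map f) (mapHom f G) := by
  refine ⟨?_, ?_, fun n hn => ?_⟩
  · rw [aug_map, aug_map]
    exact Ideal.map_mono hG.aug_le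
  · rw [aug_map]
    have := Ideal.mem_map_of_mem f hG.zero
    rwa [map_sub, map_one] at this
  · change (C'.d n).map f * (G (n + 1)).map f = (G n).map f * (C.d n).map f
    rw [← Matrix.map_mul, hG.comm n hn, Matrix.map_mul]

theorem Htpy.map {N : ℕ} {G G'} (h : Htpy N C C' G G') :
    Htpy N (C.map f) (C'.map f) (mapHom f G) (mapHom f G') := by
  obtain ⟨h, h0, h1⟩ := h
  refine ⟨fun n => (h n).map f, ?_, fun n hn => ?_⟩
  · change (G 0).map f - (G' 0).map f = (C'.d 0).map f * (h 0).map f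
    rw [← Matrix.map_mul, ← h0, Matrix.map_sub _ (map_sub f)]
  · change (G (n + 1)).map f - (G' (n + 1)).map f
      = (C'.d (n + 1)).map f * (h (n + 1)).map f + (h n).map f * (C.d n).map f
    rw [← Matrix.map_mul, ← Matrix.map_mul, ← Matrix.map_add _ (map_add f), ← h1 n hn,
      Matrix.map_sub _ (map_sub f)]

end BaseChange

end MatCx

end PairLocalHomology

namespace PairLocalHomology

open Matrix

namespace MatCx

variable {A : Type u} [CommRing A] {B : Type v} [CommRing B]

/-! ### Mapping cones of multiplication by an element -/

section Cone

/-- The index types of the mapping cone. -/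
def ConeIndex (C : MatCx A) : ℕ → Type
  | 0 => C.ι 0
  | n + 1 => C.ι (n + 1) ⊕ C.ι n

instance (C : MatCx A) : ∀ n, Fintype (C.ConeIndex n)
  | 0 => C.fintype 0
  | n + 1 => inferInstanceAs (Fintype (C.ι (n + 1) ⊕ C.ι n))

instance (C : MatCx A) : ∀ n, DecidableEq (C.ConeIndex n)
  | 0 => C.decEq 0
  | n + 1 => inferInstanceAs (DecidableEq (C.ι (n + 1) ⊕ C.ι n))

/-- The differentials of the mapping cone of multiplication by `y`. -/
def coneD (C : MatCx A) (y : A) : ∀ n, Matrix (C.ConeIndex n) (C.ConeIndex (n + 1)) A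
  | 0 => Matrix.fromCols (C.d 0) (y • (1 : Matrix (C.ι 0) (C.ι 0) A))
  | n + 1 => Matrix.fromBlocks (C.d (n + 1)) (y • (1 : Matrix (C.ι (n + 1)) (C.ι (n + 1)) A)) 0
      (-C.d n)

section Blocks

variable {k l m n k' l' m' : Type*}

theorem fromCols_mul_fromBlocks_cone [Fintype k] [Fintype l] [DecidableEq k] [DecidableEq l]
    {D : Matrix k l A} {E : Matrix l m A} (h : D * E = 0) (y : A) :
    fromCols D (y • (1 : Matrix k k A)) * fromBlocks E (y • (1 : Matrix l l A)) 0 (-D) = 0 := by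
  rw [fromCols_mul_fromBlocks, h]
  simp

theorem fromBlocks_mul_fromBlocks_cone [Fintype l] [Fintype m] [DecidableEq l] [DecidableEq m]
    {D : Matrix k l A} {E : Matrix l m A} {F : Matrix m n A}
    (h : D * E = 0) (h' : E * F = 0) (y : A) :
    fromBlocks E (y • (1 : Matrix l l A)) 0 (-D) * fromBlocks F (y • (1 : Matrix m m A)) 0 (-E)
      = 0 := by
  rw [fromBlocks_multiply, h']
  simp [h]

/-- The shifted block carries the factor `c` because multiplication by `y * c` on the source must
correspond to multiplication by `y` on the target. -/
theorem fromCols_mul_fromBlocks_hom [Fintype k] [Fintype l] [Fintype k'] [Fintype l']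
    [DecidableEq k] [DecidableEq k'] {D : Matrix k l A}
    {D' : Matrix k' l' A} {G : Matrix k' k A}
    {G' : Matrix l' l A} (h : D' * G' = G * D) (y c : A) :
    fromCols D' (y • (1 : Matrix k' k' A)) * fromBlocks G' 0 0 (c • G) =
      G * fromCols D ((y * c) • (1 : Matrix k k A)) := by
  rw [fromCols_mul_fromBlocks, mul_fromCols, h]
  simp [smul_smul, mul_comm c]

theorem fromBlocks_mul_fromBlocks_hom [Fintype k] [Fintype l] [Fintype m] [Fintype k']
    [Fintype l'] [Fintype m'] [DecidableEq l] [DecidableEq l'] {D : Matrix k l A}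
    {D' : Matrix k' l' A} {G : Matrix k' k A}
    {G' : Matrix l' l A} {E : Matrix l m A} {E' : Matrix l' m' A} {G'' : Matrix m' m A}
    (h : D' * G' = G * D) (h' : E' * G'' = G' * E) (y c : A) :
    fromBlocks E' (y • (1 : Matrix l' l' A)) 0 (-D') * fromBlocks G'' 0 0 (c • G') =
      fromBlocks G' 0 0 (c • G) * fromBlocks E ((y * c) • (1 : Matrix l l A)) 0 (-D) := by
  rw [fromBlocks_multiply, fromBlocks_multiply, h']
  simp [h, smul_smul, mul_comm c]

theorem smul_one_map [DecidableEq k] (f : A →+* B) (y : A) :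
    (y • (1 : Matrix k k A)).map f = f y • (1 : Matrix k k B) := by
  ext i j
  by_cases hij : i = j <;> simp [hij]

theorem fromCols_map (f : A →+* B) (X : Matrix k l A) (Y : Matrix k m A) :
    (fromCols X Y).map f = fromCols (X.map f) (Y.map f) := by
  ext i (j | j) <;> rfl

theorem fromBlocks_hom_map (f : A →+* B) (G : Matrix k' k A) (G' : Matrix l' l A) (c : A) :
    (fromBlocks G' 0 0 (c • G)).map f = fromBlocks (G'.map f) 0 0 (f c • G.map f) := by
  have h : (c • G).map f = f c • G.map f := by
    ext i j
    simp
  rw [fromBlocks_map, Matrix.map_zero _ (map_zero f), Matrix.map_zero _ (map_zero f), h]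

theorem fromCols_smul_one_mulVec [Fintype k] [Fintype l] [DecidableEq k]
    (D : Matrix k l A) (y : A) (a : l → A) (b : k → A) :
    fromCols D (y • (1 : Matrix k k A)) *ᵥ Sum.elim a b = D *ᵥ a + y • b := by
  rw [fromCols_mulVec_sumElim, smul_mulVec, one_mulVec]

end Blocks

/-- The mapping cone of multiplication by `y` on `C`. -/
def cone (C : MatCx A) (y : A) : MatCx A where
  ι := C.ConeIndex
  pt := C.pt
  eq_pt := C.eq_pt
  d := C.coneD y
  d_mul_d n := match n with
    | 0 => fromCols_mul_fromBlocks_cone (C.d_mul_d 0) y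
    | n + 1 => fromBlocks_mul_fromBlocks_cone (C.d_mul_d n) (C.d_mul_d (n + 1)) y

/-- The map of mapping cones given by `G` and `c • G`. -/
def coneHom {C C' : MatCx A} (c : A) (G : ∀ n, Matrix (C'.ι n) (C.ι n) A) :
    ∀ n, Matrix (C'.ConeIndex n) (C.ConeIndex n) A
  | 0 => G 0
  | n + 1 => Matrix.fromBlocks (G (n + 1)) 0 0 (c • G n)

theorem coneD_map (C : MatCx A) (y : A) (f : A →+* B) (n : ℕ) :
    (C.coneD y n).map f = (C.map f).coneD (f y) n := by
  cases n with
  | zero =>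
    exact (fromCols_map f _ _).trans (congrArg (fromCols ((C.d 0).map f)) (smul_one_map f y))
  | succ n =>
    refine (Matrix.fromBlocks_map _ _ _ _ _).trans ?_
    rw [Matrix.map_zero _ (map_zero f), smul_one_map, Matrix.map_neg _ (map_neg f)]
    rfl

theorem coneHom_map {C C' : MatCx A} (c : A) (G : ∀ n, Matrix (C'.ι n) (C.ι n) A) (f : A →+* B)
    (n : ℕ) :
    (coneHom c G n).map f = coneHom (C := C.map f) (C' := C'.map f) (f c) (mapHom f G) n :=
  match n with
  | 0 => rfl
  | n + 1 => fromBlocks_hom_map f (G n) (G (n + 1)) c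

variable {C C' : MatCx A}

theorem aug_cone (C : MatCx A) (y : A) : (C.cone y).aug = C.aug ⊔ Ideal.span {y} := by
  have h : Set.range ((C.cone y).d 0 (C.cone y).pt) = Set.range (C.d 0 C.pt) ∪ {y} := by
    ext a
    simp only [Set.mem_range, Set.mem_union, Set.mem_singleton_iff]
    constructor
    · rintro ⟨j | j, rfl⟩
      · exact Or.inl ⟨j, rfl⟩
      · right
        change (y • (1 : Matrix (C.ι 0) (C.ι 0) A)) C.pt j = y
        rw [C.eq_pt j]
        simp
    · rintro (⟨j, rfl⟩ | rfl)
      · exact ⟨Sum.inl j, rfl⟩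
      · refine ⟨Sum.inr C.pt, ?_⟩
        change (a • (1 : Matrix (C.ι 0) (C.ι 0) A)) C.pt C.pt = a
        simp
  rw [aug, h, Ideal.span_union]
  rfl

theorem IsHom.cone {N : ℕ} {G} (hG : IsHom N C C' G) (y y' c : A) (h : y = y' * c) :
    IsHom N (C.cone y) (C'.cone y') (coneHom c G) := by
  refine ⟨?_, ?_, fun n hn => ?_⟩
  · rw [aug_cone, aug_cone]
    refine sup_le_sup hG.aug_le ?_
    rw [Ideal.span_singleton_le_span_singleton, h]
    exact dvd_mul_right _ _
  · rw [aug_cone]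
    exact Ideal.mem_sup_left hG.zero
  · subst h
    cases n with
    | zero => exact fromCols_mul_fromBlocks_hom (hG.comm 0 hn) y' c
    | succ n => exact fromBlocks_mul_fromBlocks_hom (hG.comm n (by omega)) (hG.comm (n + 1) hn) y' c

theorem cone_d_zero_mulVec (y : A) (a : C.ι 1 → A) (b : C.ι 0 → A) :
    (C.cone y).d 0 *ᵥ Sum.elim a b = C.d 0 *ᵥ a + y • b :=
  fromCols_smul_one_mulVec _ _ _ _

theorem cone_d_succ_mulVec (y : A) (n : ℕ) (a : C.ι (n + 2) → A) (b : C.ι (n + 1) → A) :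
    (C.cone y).d (n + 1) *ᵥ Sum.elim a b =
      Sum.elim (C.d (n + 1) *ᵥ a + y • b) (-(C.d n *ᵥ b)) := by
  refine (Matrix.fromBlocks_mulVec _ _ _ _ _).trans ?_
  simp only [Sum.elim_comp_inl, Sum.elim_comp_inr, Matrix.smul_mulVec, Matrix.one_mulVec,
    Matrix.zero_mulVec, zero_add, Matrix.neg_mulVec]

theorem coneHom_succ_mulVec (c : A) (G : ∀ n, Matrix (C'.ι n) (C.ι n) A) (n : ℕ)
    (a : C.ι (n + 1) → A) (b : C.ι n → A) :
    coneHom c G (n + 1) *ᵥ Sum.elim a b = Sum.elim (G (n + 1) *ᵥ a) (c • (G n *ᵥ b)) := by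
  refine (Matrix.fromBlocks_mulVec _ _ _ _ _).trans ?_
  simp only [Sum.elim_comp_inl, Sum.elim_comp_inr, Matrix.smul_mulVec,
    Matrix.zero_mulVec, zero_add, add_zero]

/-- A diagram chase in the long exact sequence of the cone. For a cycle `(a, b)`, the hypothesis `h`
makes `c • F b` a boundary `d w`; then `F a + y' w` is a cycle of `C'`, and `G` makes it a boundary.
Thus one transition map treats the shifted part and a second one the unshifted part. -/
theorem Kills.cone {C'' : MatCx A} {G F} {n : ℕ} {y y' y'' c c' : A} (hG : Kills n C' C'' G)
    (hGh : IsHom (n + 2) C' C'' G) (hF : IsHom (n + 1) C C' F) (hy' : y' = y'' * c')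
    (hy : y = y' * c)
    (h : ∀ a b, (C.cone y).d n *ᵥ Sum.elim a b = 0 → ∃ w, C'.d n *ᵥ w = c • (F n *ᵥ b)) :
    Kills n (C.cone y) (C''.cone y'') (coneHom (c' * c) (comp G F)) := by
  intro z hz
  obtain ⟨a, b, rfl⟩ : ∃ (a : C.ι (n + 1) → A) (b : C.ι n → A), z = Sum.elim a b :=
    ⟨_, _, (Sum.elim_comp_inl_inr z).symm⟩
  obtain ⟨w, hw⟩ := h a b hz
  have hab : C.d n *ᵥ a + y • b = 0 := by
    cases n with
    | zero => rwa [cone_d_zero_mulVec] at hz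
    | succ n =>
      rw [cone_d_succ_mulVec] at hz
      exact funext fun i => congrFun hz (Sum.inl i)
  have hab' : C'.d n *ᵥ (F (n + 1) *ᵥ a + y' • w) = 0 := by
    rw [mulVec_add, mulVec_smul, hw, mulVec_mulVec, hF.comm n (by omega), ← mulVec_mulVec,
      smul_smul, ← hy, ← mulVec_smul, ← mulVec_add, hab, mulVec_zero]
  obtain ⟨v, hv⟩ := hG _ hab'
  -- The second entry cancels the surplus `y' • G w` in `d v`, since `y' = y'' * c'`; its own
  -- boundary, with the sign of the cone, is `c' * c` times `G F b`.
  refine ⟨Sum.elim v (-(c' • (G (n + 1) *ᵥ w))), ?_⟩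
  rw [cone_d_succ_mulVec, hv]
  refine Eq.trans ?_ (coneHom_succ_mulVec _ _ n a b).symm
  congr 1
  · rw [mulVec_add, mulVec_mulVec, mulVec_smul, smul_neg, smul_smul, ← hy', add_neg_cancel_right]
    rfl
  · rw [mulVec_neg, neg_neg, mulVec_smul, mulVec_mulVec, hGh.comm n (by omega), ← mulVec_mulVec,
      hw, mulVec_smul, smul_smul, mulVec_mulVec]
    rfl

/-- In degree `0` the cycle condition says that `y * b` lies in the augmentation ideal. So `b` is
`y`-torsion modulo this ideal, and `h` replaces `y` by the annihilator `z`. -/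
theorem IsHom.exists_mulVec_eq_smul {N : ℕ} {F} (hF : IsHom N C C' F) {y z : A}
    (h : ∀ w, y * w ∈ C'.aug → z * w ∈ C'.aug) (a : C.ι 1 → A) (b : C.ι 0 → A)
    (hab : (C.cone y).d 0 *ᵥ Sum.elim a b = 0) : ∃ w, C'.d 0 *ᵥ w = z • (F 0 *ᵥ b) := by
  rw [cone_d_zero_mulVec] at hab
  have hb : y * b C.pt ∈ C'.aug := by
    refine hF.aug_le (mem_aug.2 ⟨-a, ?_⟩)
    rw [mulVec_neg, eq_neg_of_add_eq_zero_left hab]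
    exact neg_neg _
  have hFb : (F 0 *ᵥ b) C'.pt = F 0 C'.pt C.pt * b C.pt :=
    Fintype.sum_eq_single _ fun i hi => absurd (C.eq_pt i) hi
  obtain ⟨w, hw⟩ := mem_aug.1 (C'.aug.mul_mem_left (F 0 C'.pt C.pt) (h _ hb))
  refine ⟨w, funext fun i => ?_⟩
  rw [C'.eq_pt i, hw, Pi.smul_apply, hFb, smul_eq_mul]
  ring

theorem Kills.map_cone {n : ℕ} {y y' c : A} {G} {f : A →+* B}
    (h : Kills n ((C.map f).cone (f y)) ((C'.map f).cone (f y')) (coneHom (f c) (mapHom f G))) :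
    Kills n ((C.cone y).map f) ((C'.cone y').map f) (mapHom f (coneHom c G)) := by
  intro z hz
  change (C.coneD y n).map f *ᵥ z = 0 at hz
  rw [coneD_map] at hz
  obtain ⟨w, hw⟩ := h z hz
  refine ⟨w, ?_⟩
  change (C'.coneD y' (n + 1)).map f *ᵥ w = (coneHom c G (n + 1)).map f *ᵥ z
  rw [coneD_map, coneHom_map]
  exact hw

end Cone

/-! ### Koszul complexes and the pro-vanishing of their homology -/

section Koszul

/-- The complex `A` in degree `0`. -/
def unit (A : Type u) [CommRing A] : MatCx A where
  ι n := match n with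
    | 0 => Unit
    | _ + 1 => Empty
  fintype n := match n with
    | 0 => inferInstanceAs (Fintype Unit)
    | _ + 1 => inferInstanceAs (Fintype Empty)
  decEq n := match n with
    | 0 => inferInstanceAs (DecidableEq Unit)
    | _ + 1 => inferInstanceAs (DecidableEq Empty)
  pt := ()
  eq_pt _ := rfl
  d _ := 0
  d_mul_d _ := Matrix.zero_mul _

/-- The Koszul complex on the `t`-th powers of the elements of a list. -/
def koszul : List A → ℕ → MatCx A
  | [], _ => unit A
  | y :: l, t => (koszul l t).cone (y ^ t)

/-- The canonical map between the Koszul complexes on the `s`-th and on the `t`-th powers. -/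
def koszulMap (s t : ℕ) : ∀ (l : List A) (n : ℕ), Matrix ((koszul l t).ι n) ((koszul l s).ι n) A
  | [] => (unit A).one
  | y :: l => coneHom (y ^ (s - t)) (koszulMap s t l)

theorem isHom_koszulMap {s t : ℕ} (h : t ≤ s) (N : ℕ) :
    ∀ l : List A, IsHom N (koszul l s) (koszul l t) (koszulMap s t l)
  | [] => isHom_one N
  | y :: l => (isHom_koszulMap h N l).cone _ _ _ (by rw [← pow_add, Nat.add_sub_cancel' h])

theorem aug_koszul (t : ℕ) : ∀ l : List A, (koszul l t).aug = Ideal.span ((· ^ t) '' {x | x ∈ l})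
  | [] => by
    have : {x : A | x ∈ ([] : List A)} = ∅ := by simp
    rw [this, Set.image_empty, aug, Ideal.span_empty, eq_bot_iff, Ideal.span_le]
    rintro _ ⟨j, _⟩
    exact j.elim
  | y :: l => by
    have : {x : A | x ∈ y :: l} = {x | x ∈ l} ∪ {y} := by
      ext
      simp
    rw [koszul, aug_cone, aug_koszul t l, this, Set.image_union, Ideal.span_union,
      Set.image_singleton]

/-- In a Noetherian ring the `y`-power torsion modulo an ideal is killed by one power of `y`. -/
theorem exists_pow_mul_mem [IsNoetherianRing A] (c : Ideal A) (y : A) :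
    ∃ e : ℕ, ∀ n w, y ^ n * w ∈ c → y ^ e * w ∈ c := by
  let f : ℕ →o Ideal A :=
    ⟨fun n => Submodule.comap (LinearMap.mulLeft A (y ^ n)) c, fun m n hmn w hw => by
      have := c.mul_mem_left (y ^ (n - m)) hw
      rwa [LinearMap.mulLeft_apply, ← mul_assoc, ← pow_add, Nat.sub_add_cancel hmn] at this⟩
  obtain ⟨e, he⟩ := monotone_stabilizes_iff_noetherian.2 ‹_› f
  refine ⟨e, fun n w hw => ?_⟩
  have h : w ∈ f (max n e) := f.mono (le_max_left n e) hw
  rwa [← he _ (le_max_right n e)] at h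

/-- The Koszul homology of a Noetherian ring in positive degrees is pro-zero. -/
theorem exists_kills_koszul [IsNoetherianRing B] (f : A →+* B) (l : List A) :
    ∀ n t : ℕ, ∃ s ≥ t, ∃ G, (∀ N, IsHom N (koszul l s) (koszul l t) G) ∧
      Kills n ((koszul l s).map f) ((koszul l t).map f) (mapHom f G) := by
  induction l with
  | nil =>
    exact fun n t => ⟨t, le_rfl, _, fun N => isHom_one N, fun z _ => ⟨0, funext fun i => i.elim⟩⟩
  | cons y l ih =>
    intro n t
    -- `G` is the second transition map of `Kills.cone`, from `t'` to `t`; the first one, `F` from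
    -- `s` to `t'`, has to treat the shifted part `b` of a cycle.
    obtain ⟨t', ht, G, hG, hGk⟩ := ih n t
    have hy' : y ^ t' = y ^ t * y ^ (t' - t) := by rw [← pow_add, Nat.add_sub_cancel' ht]
    suffices ∃ s ≥ t', ∃ F, (∀ N, IsHom N (koszul l s) (koszul l t') F) ∧
        ∀ a b, (((koszul l s).map f).cone (f (y ^ s))).d n *ᵥ Sum.elim a b = 0 →
          ∃ w, ((koszul l t').map f).d n *ᵥ w = f (y ^ (s - t')) • (mapHom f F n *ᵥ b) by
      obtain ⟨s, hs, F, hF, h⟩ := this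
      have hy : y ^ s = y ^ t' * y ^ (s - t') := by rw [← pow_add, Nat.add_sub_cancel' hs]
      refine ⟨s, ht.trans hs, coneHom (y ^ (t' - t) * y ^ (s - t')) (comp G F),
        fun N => ((hG N).comp (hF N)).cone _ _ _ (by rw [← mul_assoc, ← hy', ← hy]), ?_⟩
      apply Kills.map_cone
      rw [map_mul, mapHom_comp]
      exact hGk.cone (y' := f (y ^ t')) ((hG _).map f) ((hF _).map f) (by rw [hy', map_mul])
        (by rw [hy, map_mul]) h
    -- In homological degree `1` the shifted part is torsion modulo the augmentation ideal, and a
    -- fixed power `y ^ e` kills it by the ascending chain condition. In higher degrees it is itself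
    -- a cycle of positive degree, and the induction hypothesis applies.
    cases n with
    | zero =>
      obtain ⟨e, he⟩ := exists_pow_mul_mem ((koszul l t').map f).aug (f y)
      refine ⟨t' + e, Nat.le_add_right _ _, koszulMap (t' + e) t' l,
        fun N => isHom_koszulMap (Nat.le_add_right _ _) N l, fun a b hab => ?_⟩
      rw [map_pow] at hab
      rw [Nat.add_sub_cancel_left, map_pow]
      exact ((isHom_koszulMap (Nat.le_add_right t' e) 0 l).map f).exists_mulVec_eq_smul
        (he (t' + e)) a b hab
    | succ n =>
      obtain ⟨s, hs, F, hF, hFk⟩ := ih n t'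
      refine ⟨s, hs, F, hF, fun a b hab => ?_⟩
      rw [cone_d_succ_mulVec] at hab
      obtain ⟨w, hw⟩ := hFk b (by
        funext i
        exact neg_eq_zero.1 (congrFun hab (Sum.inr i)))
      exact ⟨f (y ^ (s - t')) • w, by rw [mulVec_smul, hw]⟩

/-- Every complex `D` with `D.aug` small enough has a map to a given Koszul complex. -/
theorem exists_isHom_koszul [IsNoetherianRing B] (f : A →+* B) (l : List A) (N t : ℕ) :
    ∃ s ≥ t, ∀ D : MatCx B, D.aug ≤ (koszul l s).aug.map f →
      ∃ E, IsHom N D ((koszul l t).map f) E := by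
  -- The bound is raised by one because the lifting starts with degrees at most `1`.
  suffices ∃ s ≥ t, ∀ D : MatCx B, D.aug ≤ (koszul l s).aug.map f →
      ∃ E, IsHom (N + 1) D ((koszul l t).map f) E by
    obtain ⟨s, hs, h⟩ := this
    exact ⟨s, hs, fun D hD => (h D hD).imp fun E hE => hE.mono (Nat.le_succ N)⟩
  induction N generalizing t with
  | zero => exact ⟨t, le_rfl, fun D hD => exists_isHom_one (by rwa [aug_map])⟩
  | succ N ih =>
    -- The transition map that permits the last extension is chosen first; its source is then the
    -- target of the lift from the induction hypothesis.
    obtain ⟨t', ht, G, hG, hGk⟩ := exists_kills_koszul f l N t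
    obtain ⟨s, hs, h⟩ := ih t'
    refine ⟨s, ht.trans hs, fun D hD => ?_⟩
    obtain ⟨E, hE⟩ := h D hD
    exact hE.exists_succ ((hG _).map f) hGk

/-- Two maps to a Koszul complex become homotopic after a transition map. -/
theorem exists_htpy_koszul [IsNoetherianRing B] (f : A →+* B) (l : List A) (N t : ℕ) :
    ∃ s ≥ t, ∃ G, (∀ N, IsHom N (koszul l s) (koszul l t) G) ∧
      ∀ (D : MatCx B) (E E'), IsHom N D ((koszul l s).map f) E →
        IsHom N D ((koszul l s).map f) E' →
          Htpy N D ((koszul l t).map f) (comp (mapHom f G) E) (comp (mapHom f G) E') := by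
  induction N generalizing t with
  | zero =>
    refine ⟨t, le_rfl, _, fun N => isHom_one N, fun D E E' hE hE' => ?_⟩
    exact (hE.htpy_zero hE').comp_left ((isHom_one 1).map f)
  | succ N ih =>
    obtain ⟨t', ht, G, hG, hGk⟩ := exists_kills_koszul f l N t
    obtain ⟨s, hs, F, hF, h⟩ := ih t'
    refine ⟨s, ht.trans hs, comp G F, fun N => (hG N).comp (hF N), fun D E E' hE hE' => ?_⟩
    rw [mapHom_comp, comp_assoc, comp_assoc]
    exact (h D E E' (hE.mono (Nat.le_succ N)) (hE'.mono (Nat.le_succ N))).exists_succ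
      (((hF _).map f).comp hE) (((hF _).map f).comp hE') ((hG _).map f) hGk

/-- Together with `aug_koszul_le` this says that the ideals generated by the `t`-th powers are
cofinal with the powers of the ideal. It holds because a finitely generated ideal inside a radical
has a power inside the ideal itself. -/
theorem exists_pow_le_aug_koszul (l : List A) (t : ℕ) :
    ∃ s, Ideal.span {x | x ∈ l} ^ s ≤ (koszul l t).aug := by
  refine Ideal.exists_pow_le_of_le_radical_of_fg ?_
    (Submodule.fg_span (List.finite_toSet l))
  rw [Ideal.span_le, aug_koszul]
  exact fun x hx => ⟨t, Ideal.subset_span ⟨x, hx, rfl⟩⟩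

theorem aug_koszul_le (l : List A) (t : ℕ) : (koszul l t).aug ≤ Ideal.span {x | x ∈ l} ^ t := by
  rw [aug_koszul, Ideal.span_le]
  rintro _ ⟨x, hx, rfl⟩
  exact Ideal.pow_mem_pow (Ideal.subset_span hx) t

end Koszul

end MatCx

end PairLocalHomology

namespace PairLocalHomology

open Matrix

namespace MatCx

variable {A : Type u} [CommRing A]

/-! ### Finite free resolutions over a Noetherian ring -/

section Resolution

theorem exists_matrix_exact [IsNoetherianRing A] {m n : ℕ} (D : Matrix (Fin m) (Fin n) A) :
    ∃ (k : ℕ) (E : Matrix (Fin n) (Fin k) A), D * E = 0 ∧ ∀ z, D *ᵥ z = 0 → ∃ w, E *ᵥ w = z := by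
  obtain ⟨k, s, hs⟩ := Submodule.fg_iff_exists_fin_generating_family.1
    (IsNoetherian.noetherian (LinearMap.ker D.mulVecLin))
  refine ⟨k, Matrix.of fun i j => s j i, ?_, fun z hz => ?_⟩
  · ext i j
    have hj : s j ∈ LinearMap.ker D.mulVecLin := hs ▸ Submodule.subset_span ⟨j, rfl⟩
    exact congrFun hj i
  · have hz' : z ∈ Submodule.span A (Set.range s) := hs ▸ hz
    obtain ⟨c, rfl⟩ := (Submodule.mem_span_range_iff_exists_fun A).1 hz'
    refine ⟨c, funext fun i => ?_⟩
    simp [Matrix.mulVec, dotProduct, mul_comm]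

/-- A matrix of some finite size. -/
abbrev FinMatrix (A : Type u) : Type u := Σ (m n : ℕ), Matrix (Fin m) (Fin n) A

/-- The matrices of a resolution which begins with a given matrix. -/
noncomputable def resAux [IsNoetherianRing A] (D : FinMatrix A) : ℕ → FinMatrix A
  | 0 => D
  | n + 1 => ⟨_, _, (exists_matrix_exact (resAux D n).2.2).choose_spec.choose⟩

theorem resAux_mul [IsNoetherianRing A] (D : FinMatrix A) (n : ℕ) :
    (resAux D n).2.2 * (exists_matrix_exact (resAux D n).2.2).choose_spec.choose = 0 :=
  (exists_matrix_exact (resAux D n).2.2).choose_spec.choose_spec.1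

/-- A row with entries generating the ideal `c`. -/
noncomputable def genRow [IsNoetherianRing A] (c : Ideal A) : FinMatrix A :=
  ⟨1, (Submodule.fg_iff_exists_fin_generating_family.1 (IsNoetherian.noetherian c)).choose,
    Matrix.of fun _ =>
      (Submodule.fg_iff_exists_fin_generating_family.1
        (IsNoetherian.noetherian c)).choose_spec.choose⟩

/-- A resolution of `A ⧸ c` by finite free modules. -/
noncomputable def res [IsNoetherianRing A] (c : Ideal A) : MatCx A where
  ι n := Fin (resAux (genRow c) n).1
  pt := (0 : Fin 1)
  eq_pt := Fin.eq_zero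
  d n := (resAux (genRow c) n).2.2
  d_mul_d n := resAux_mul _ n

theorem res_exact [IsNoetherianRing A] (c : Ideal A) : (res c).Exact := fun n =>
  (exists_matrix_exact (resAux (genRow c) n).2.2).choose_spec.choose_spec.2

theorem aug_res [IsNoetherianRing A] (c : Ideal A) : (res c).aug = c :=
  (Submodule.fg_iff_exists_fin_generating_family.1
    (IsNoetherian.noetherian c)).choose_spec.choose_spec

end Resolution

/-! ### Homology with coefficients in a module -/

section Homology

variable (M : Type w) [AddCommGroup M] [Module A M]

/-- The action of a matrix on vectors with entries in a module. -/
def act {m n : Type*} [Fintype n] (D : Matrix m n A) : (n → M) →ₗ[A] (m → M) where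
  toFun v i := ∑ j, D i j • v j
  map_add' v w := by
    ext i
    simp [smul_add, Finset.sum_add_distrib]
  map_smul' a v := by
    ext i
    simp [Finset.smul_sum, smul_comm a]

theorem act_mul {l m n : Type*} [Fintype m] [Fintype n] (D : Matrix l m A) (E : Matrix m n A)
    (v : n → M) : act M (D * E) v = act M D (act M E v) := by
  ext i
  simp only [act, LinearMap.coe_mk, AddHom.coe_mk, Matrix.mul_apply, Finset.sum_smul,
    Finset.smul_sum, mul_smul]
  exact Finset.sum_comm

theorem act_add {m n : Type*} [Fintype n] (D E : Matrix m n A) (v : n → M) :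
    act M (D + E) v = act M D v + act M E v := by
  ext i
  simp [act, add_smul, Finset.sum_add_distrib]

theorem act_sub {m n : Type*} [Fintype n] (D E : Matrix m n A) (v : n → M) :
    act M (D - E) v = act M D v - act M E v := by
  ext i
  simp [act, sub_smul]

/-- The cycles of degree `i` with coefficients in `M`. -/
def cycles (C : MatCx A) : ∀ i : ℕ, Submodule A (C.ι i → M)
  | 0 => ⊤
  | i + 1 => LinearMap.ker (act M (C.d i))

/-- The homology in degree `i` with coefficients in `M`. -/
def H (C : MatCx A) (i : ℕ) : Type w :=
  cycles M C i ⧸ (LinearMap.range (act M (C.d i))).submoduleOf (cycles M C i)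

instance (C : MatCx A) (i : ℕ) : AddCommGroup (H M C i) :=
  inferInstanceAs (AddCommGroup (cycles M C i ⧸ Submodule.submoduleOf _ _))

/-- The second ring `S` lets homology of a complex over `R'` be regarded over `R` as well, as the
corollary requires. -/
instance {S : Type*} [Semiring S] [SMul S A] [Module S M] [IsScalarTower S A M] (C : MatCx A)
    (i : ℕ) : Module S (H M C i) :=
  inferInstanceAs (Module S (cycles M C i ⧸ Submodule.submoduleOf _ _))

instance {S : Type*} [Semiring S] [SMul S A] [Module S M] [IsScalarTower S A M] (C : MatCx A)
    (i : ℕ) : IsScalarTower S A (H M C i) :=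
  inferInstanceAs (IsScalarTower S A (cycles M C i ⧸ Submodule.submoduleOf _ _))

/-- The homology class of a cycle. -/
def H.mk (C : MatCx A) (i : ℕ) : cycles M C i →ₗ[A] H M C i := Submodule.mkQ _

variable {M}
variable {C C' C'' : MatCx A}

theorem H.mk_surjective {i : ℕ} : Function.Surjective (H.mk M C i) := Submodule.mkQ_surjective _

theorem H.mk_eq_mk_iff {i : ℕ} {v w : cycles M C i} :
    H.mk M C i v = H.mk M C i w ↔ ∃ x, act M (C.d i) x = v.1 - w.1 :=
  Submodule.Quotient.eq _

theorem IsHom.act_mem_cycles {i : ℕ} {G} (hG : IsHom (i + 1) C C' G) {v : C.ι i → M}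
    (hv : v ∈ cycles M C i) : act M (G i) v ∈ cycles M C' i := by
  cases i with
  | zero => trivial
  | succ i =>
    change act M (C'.d i) (act M (G (i + 1)) v) = 0
    rw [← act_mul, hG.comm i (by omega), act_mul, show act M (C.d i) v = 0 from hv, map_zero]

/-- The map on homology induced by a chain map. -/
def IsHom.mapH (M : Type w) [AddCommGroup M] [Module A M] {i : ℕ} {G}
    (hG : IsHom (i + 1) C C' G) : H M C i →ₗ[A] H M C' i :=
  Submodule.mapQ _ _ ((act M (G i)).restrict fun _ hv => hG.act_mem_cycles hv) (by
    rintro ⟨v, hv⟩ ⟨w, rfl⟩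
    refine ⟨act M (G (i + 1)) w, ?_⟩
    change act M (C'.d i) _ = act M (G i) (act M (C.d i) w)
    rw [← act_mul, hG.comm i (by omega), act_mul])

variable (M) in
theorem IsHom.mapH_comp {i : ℕ} {G F} (hG : IsHom (i + 1) C' C'' G) (hF : IsHom (i + 1) C C' F)
    (x : H M C i) : (hG.comp hF).mapH M x = hG.mapH M (hF.mapH M x) := by
  obtain ⟨⟨v, hv⟩, rfl⟩ := H.mk_surjective x
  exact congrArg (H.mk M _ i) (Subtype.ext (act_mul M (G i) (F i) v))

variable (M) in
theorem Htpy.mapH_eq {i : ℕ} {G G'} (h : Htpy i C C' G G') (hG : IsHom (i + 1) C C' G)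
    (hG' : IsHom (i + 1) C C' G') (x : H M C i) : hG.mapH M x = hG'.mapH M x := by
  obtain ⟨⟨v, hv⟩, rfl⟩ := H.mk_surjective x
  obtain ⟨h, h0, h1⟩ := h
  refine H.mk_eq_mk_iff.2 ⟨act M (h i) v, ?_⟩
  change act M (C'.d i) _ = act M (G i) v - act M (G' i) v
  rw [← act_sub, ← act_mul]
  cases i with
  | zero => rw [h0]
  | succ i =>
    rw [h1 i (by omega), act_add, act_mul M (h i), show act M (C.d i) v = 0 from hv, map_zero,
      add_zero]

end Homology

/-! ### The base change maps on Tor form a pro-isomorphism -/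

section BaseChange

variable {R : Type u} [CommRing R] [IsNoetherianRing R] {R' : Type v} [CommRing R']
  [IsNoetherianRing R'] (f : R →+* R') (M : Type w) [AddCommGroup M] [Module R' M]

theorem exists_list_span (a : Ideal R) : ∃ l : List R, Ideal.span {x | x ∈ l} = a := by
  obtain ⟨S, hS⟩ := IsNoetherian.noetherian a
  refine ⟨S.toList, ?_⟩
  rw [← hS]
  simp

/-- The kernels of the maps `Tor_i^R(R ⧸ a ^ s, M) → Tor_i^{R'}(R' ⧸ (a R') ^ s, M)` form a
pro-zero system. -/
theorem exists_mapH_eq_zero (a : Ideal R) (i t : ℕ) : ∃ s₀ ≥ t, ∀ s ≥ s₀,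
    ∀ {θ} (hθ : IsHom (i + 1) ((res (a ^ s)).map f) (res (a.map f ^ s)) θ)
      {τ} (hτ : IsHom (i + 1) (res (a ^ s)) (res (a ^ t)) τ) (x : H M ((res (a ^ s)).map f) i),
      hθ.mapH M x = 0 → (hτ.map f).mapH M x = 0 := by
  obtain ⟨l, hl⟩ := exists_list_span a
  obtain ⟨s₁, -, G, hG, hh⟩ := exists_htpy_koszul f l i t
  obtain ⟨s₂, -, hE⟩ := exists_isHom_koszul (RingHom.id R) l (i + 1) s₁
  obtain ⟨s₂', -, hE'⟩ := exists_isHom_koszul f l (i + 1) s₁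
  obtain ⟨s₃, h₃⟩ := exists_pow_le_aug_koszul l s₂
  obtain ⟨s₃', h₃'⟩ := exists_pow_le_aug_koszul l s₂'
  rw [hl] at h₃ h₃'
  refine ⟨max t (max s₃ s₃'), le_max_left _ _, fun s hs θ hθ τ hτ x hx => ?_⟩
  have hs₃ : s₃ ≤ s := le_trans (by simp) hs
  have hs₃' : s₃' ≤ s := le_trans (by simp) hs
  obtain ⟨E, hE⟩ : ∃ E, IsHom (i + 1) (res (a ^ s)) (koszul l s₁) E := hE (res (a ^ s)) (by
    rw [aug_res, Ideal.map_id]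
    exact (Ideal.pow_le_pow_right hs₃).trans h₃)
  obtain ⟨E', hE'⟩ := hE' (res (a.map f ^ s)) (by
    rw [aug_res, ← Ideal.map_pow]
    exact Ideal.map_mono ((Ideal.pow_le_pow_right hs₃').trans h₃'))
  obtain ⟨F, hF⟩ := (res_exact (a ^ t)).exists_isHom (D := koszul l t)
    (by rw [aug_res, ← hl]; exact aug_koszul_le l t) (i + 1)
  -- Over `R` the target is a resolution, so `τ` is homotopic to the composite `F ∘ G ∘ E` through
  -- two Koszul complexes.
  have h1 := ((res_exact (a ^ t)).htpy (hτ.mono (Nat.le_succ i))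
    ((hF.comp ((hG _).comp hE)).mono (Nat.le_succ i))).map f
  -- Over `R'` both `E` and `E' ∘ θ` map to the same Koszul complex and become homotopic after `G`.
  -- Hence `τ` factors through `θ` up to homotopy and kills whatever `θ` kills.
  have h2 := (hh _ _ _ ((hE.map f).mono (Nat.le_succ i))
    ((hE'.comp hθ).mono (Nat.le_succ i))).comp_left (hF.map f)
  rw [mapHom_comp, mapHom_comp] at h1
  rw [(h1.trans h2).mapH_eq M (hτ.map f)
    ((hF.map f).comp (((hG _).map f).comp (hE'.comp hθ))),
    (hF.map f).mapH_comp M (((hG _).map f).comp (hE'.comp hθ)),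
    ((hG _).map f).mapH_comp M (hE'.comp hθ), hE'.mapH_comp M hθ, hx, map_zero, map_zero, map_zero]

/-- The cokernels of the maps `Tor_i^R(R ⧸ a ^ s, M) → Tor_i^{R'}(R' ⧸ (a R') ^ s, M)` form a
pro-zero system. -/
theorem exists_mapH_eq_mapH (a : Ideal R) (i t : ℕ) : ∃ s ≥ t,
    ∀ {θ} (hθ : IsHom (i + 1) ((res (a ^ t)).map f) (res (a.map f ^ t)) θ)
      {τ} (hτ : IsHom (i + 1) (res (a.map f ^ s)) (res (a.map f ^ t)) τ)
      (y : H M (res (a.map f ^ s)) i), ∃ x, hθ.mapH M x = hτ.mapH M y := by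
  obtain ⟨l, hl⟩ := exists_list_span a
  obtain ⟨s₁, -, hE⟩ := exists_isHom_koszul f l (i + 1) t
  obtain ⟨s₂, h₂⟩ := exists_pow_le_aug_koszul l s₁
  rw [hl] at h₂
  refine ⟨max t s₂, le_max_left _ _, fun {θ} hθ {τ} hτ y => ?_⟩
  obtain ⟨E, hE⟩ := hE (res (a.map f ^ max t s₂)) (by
    rw [aug_res, ← Ideal.map_pow]
    exact Ideal.map_mono ((Ideal.pow_le_pow_right (le_max_right _ _)).trans h₂))
  obtain ⟨F, hF⟩ := (res_exact (a ^ t)).exists_isHom (D := koszul l t)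
    (by rw [aug_res, ← hl]; exact aug_koszul_le l t) (i + 1)
  -- The preimage is obtained by passing through the Koszul complex; `θ ∘ F ∘ E` and `τ` are
  -- homotopic because both end in a resolution over `R'`.
  refine ⟨((hF.map f).comp hE).mapH M y, ?_⟩
  rw [← hθ.mapH_comp M ((hF.map f).comp hE)]
  exact ((res_exact _).htpy ((hθ.comp ((hF.map f).comp hE)).mono (Nat.le_succ i))
    (hτ.mono (Nat.le_succ i))).mapH_eq M _ _ y

end BaseChange

end MatCx

end PairLocalHomology

namespace PairLocalHomology

open MatCx

/-! ### Extension and contraction between the two index sets -/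

section Ideals

variable {R : Type u} [CommRing R] {R' : Type v} [CommRing R'] (f : R →+* R')

/-- Here `f(J) = JR'` enters: the component of `f x` in `JR'` is the image of a single `j ∈ J`, so
`x - j` lies in the contraction of `b`. -/
theorem comap_mem_idealsOfPair {I J : Ideal R} (hJ : f '' (J : Set R) = (J.map f : Set R'))
    {b : Ideal R'} (hb : b ∈ idealsOfPair (I.map f) (J.map f)) : b.comap f ∈ idealsOfPair I J := by
  obtain ⟨n, hn, h⟩ := hb
  refine ⟨n, hn, fun x hx => ?_⟩
  have hx' : f x ∈ b ⊔ J.map f := h (by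
    rw [← Ideal.map_pow]
    exact Ideal.mem_map_of_mem f hx)
  obtain ⟨y, hy, z, hz, hyz⟩ := Submodule.mem_sup.1 hx'
  obtain ⟨j, hj, rfl⟩ : z ∈ f '' (J : Set R) := hJ ▸ hz
  refine Submodule.mem_sup.2 ⟨x - j, ?_, j, hj, sub_add_cancel x j⟩
  rw [Ideal.mem_comap, map_sub, ← hyz, add_sub_cancel_right]
  exact hy

theorem map_mem_idealsOfPair {I J a : Ideal R} (ha : a ∈ idealsOfPair I J) :
    a.map f ∈ idealsOfPair (I.map f) (J.map f) := by
  obtain ⟨n, hn, h⟩ := ha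
  refine ⟨n, hn, ?_⟩
  rw [← Ideal.map_pow, ← Ideal.map_sup]
  exact Ideal.map_mono h

theorem map_comap_pow_le (b : Ideal R') (t : ℕ) : (b.comap f ^ t).map f ≤ b ^ t := by
  rw [Ideal.map_pow]
  exact Ideal.pow_right_mono Ideal.map_comap_le t

end Ideals

/-! ### Canonical maps between Tor modules -/

section Families

variable {R : Type u} [CommRing R] [IsNoetherianRing R] {R' : Type v} [CommRing R']
  (f : R →+* R') (M : Type w) [AddCommGroup M] [Module R' M] (i : ℕ)

theorem map_pow_le {R : Type u} [CommRing R] {R' : Type v} [CommRing R'] (f : R →+* R')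
    (a : Ideal R) (s : ℕ) : (a ^ s).map f ≤ a.map f ^ s :=
  (Ideal.map_pow f a s).le

theorem mapH_congr {A : Type u} [CommRing A] (M : Type w) [AddCommGroup M] [Module A M] {i : ℕ}
    {C C' : MatCx A} {G G'} (h : G = G') (hG : IsHom (i + 1) C C' G) (hG' : IsHom (i + 1) C C' G') :
    hG.mapH M = hG'.mapH M := by
  subst h
  rfl

/-- `Tor_i^R(R ⧸ c, M)` for an `R'`-module `M`, computed from a finite free resolution. -/
abbrev TorMod (c : Ideal R) : Type w := H M ((res c).map f) i

theorem exists_isHom_res {c c' : Ideal R} (h : c ≤ c') (N : ℕ) :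
    ∃ E, IsHom N (res c) (res c') E :=
  (res_exact c').exists_isHom (by rwa [aug_res, aug_res]) N

theorem mapH_eq_mapH {c c' : Ideal R} {G G'} (hG : IsHom (i + 1) (res c) (res c') G)
    (hG' : IsHom (i + 1) (res c) (res c') G') (x : TorMod f M i c) :
    (hG.map f).mapH M x = (hG'.map f).mapH M x :=
  (((res_exact c').htpy (hG.mono (Nat.le_succ i)) (hG'.mono (Nat.le_succ i))).map f).mapH_eq M _ _ x

/-- The map `Tor_i^R(R ⧸ c, M) → Tor_i^R(R ⧸ c', M)` induced by the projection. -/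
noncomputable def torMap {c c' : Ideal R} (h : c ≤ c') : TorMod f M i c →ₗ[R'] TorMod f M i c' :=
  ((exists_isHom_res h (i + 1)).choose_spec.map f).mapH M

theorem torMap_eq {c c' : Ideal R} (h : c ≤ c') {G} (hG : IsHom (i + 1) (res c) (res c') G)
    (x : TorMod f M i c) : torMap f M i h x = (hG.map f).mapH M x :=
  mapH_eq_mapH f M i (exists_isHom_res h (i + 1)).choose_spec hG x

theorem torMap_torMap {c c' c'' : Ideal R} (h : c ≤ c') (h' : c' ≤ c'') (x : TorMod f M i c) :
    torMap f M i h' (torMap f M i h x) = torMap f M i (h.trans h') x := by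
  obtain ⟨G, hG⟩ := exists_isHom_res h (i + 1)
  obtain ⟨G', hG'⟩ := exists_isHom_res h' (i + 1)
  rw [torMap_eq f M i h hG, torMap_eq f M i h' hG', torMap_eq f M i _ (hG'.comp hG)]
  rw [mapH_congr M (mapHom_comp f G' G) _ ((hG'.map f).comp (hG.map f))]
  exact ((hG'.map f).mapH_comp M (hG.map f) x).symm

/-- Extension of scalars along the identity changes nothing, even definitionally. So Tor over `R'`
is the case `f = id` of `TorMod`. -/
theorem res_map_id_exact (c : Ideal R) : ((res c).map (RingHom.id R)).Exact := res_exact c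

variable [IsNoetherianRing R']

theorem exists_isHom_map_res {c : Ideal R} {c' : Ideal R'} (h : c.map f ≤ c') (N : ℕ) :
    ∃ E, IsHom N ((res c).map f) ((res c').map (RingHom.id R')) E :=
  (res_map_id_exact c').exists_isHom (by rwa [aug_map, aug_map, aug_res, aug_res, Ideal.map_id]) N

/-- The map `Tor_i^R(R ⧸ c, M) → Tor_i^{R'}(R' ⧸ c', M)` for an ideal `c'` which contains `c R'`. -/
noncomputable def torBaseChange {c : Ideal R} {c' : Ideal R'} (h : c.map f ≤ c') :
    TorMod f M i c →ₗ[R'] TorMod (RingHom.id R') M i c' :=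
  (exists_isHom_map_res f h (i + 1)).choose_spec.mapH M

theorem torBaseChange_eq {c : Ideal R} {c' : Ideal R'} (h : c.map f ≤ c') {G}
    (hG : IsHom (i + 1) ((res c).map f) ((res c').map (RingHom.id R')) G) (x : TorMod f M i c) :
    torBaseChange f M i h x = hG.mapH M x :=
  ((res_map_id_exact c').htpy ((exists_isHom_map_res f h (i + 1)).choose_spec.mono (Nat.le_succ i))
    (hG.mono (Nat.le_succ i))).mapH_eq M _ _ x

theorem torBaseChange_torMap {c c₁ : Ideal R} {c' : Ideal R'} (h : c ≤ c₁) (h' : c₁.map f ≤ c')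
    (x : TorMod f M i c) : torBaseChange f M i h' (torMap f M i h x) =
      torBaseChange f M i ((Ideal.map_mono h).trans h') x := by
  obtain ⟨G, hG⟩ := exists_isHom_res h (i + 1)
  obtain ⟨G', hG'⟩ := exists_isHom_map_res f h' (i + 1)
  rw [torMap_eq f M i h hG, torBaseChange_eq f M i h' hG',
    torBaseChange_eq f M i _ (hG'.comp (hG.map f))]
  exact (hG'.mapH_comp M (hG.map f) x).symm

theorem torMap_torBaseChange {c : Ideal R} {c' c'' : Ideal R'} (h : c.map f ≤ c') (h' : c' ≤ c'')
    (x : TorMod f M i c) : torMap (RingHom.id R') M i h' (torBaseChange f M i h x) =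
      torBaseChange f M i (h.trans h') x := by
  obtain ⟨G, hG⟩ := exists_isHom_map_res f h (i + 1)
  obtain ⟨G', hG'⟩ := exists_isHom_res h' (i + 1)
  rw [torBaseChange_eq f M i h hG, torMap_eq (RingHom.id R') M i h' hG',
    torBaseChange_eq f M i _ ((hG'.map (RingHom.id R')).comp hG)]
  exact ((hG'.map (RingHom.id R')).mapH_comp M hG x).symm

theorem exists_torMap_eq_zero (a : Ideal R) (t : ℕ) : ∃ s₀ ≥ t, ∀ s ≥ s₀, ∀ (hst : t ≤ s),
    ∀ x : TorMod f M i (a ^ s), torBaseChange f M i (map_pow_le f a s) x = 0 →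
      torMap f M i (Ideal.pow_le_pow_right hst) x = 0 := by
  obtain ⟨s₀, hs₀, h⟩ := exists_mapH_eq_zero f M a i t
  refine ⟨s₀, hs₀, fun s hs hst x hx => ?_⟩
  obtain ⟨τ, hτ⟩ := exists_isHom_res (Ideal.pow_le_pow_right hst : a ^ s ≤ a ^ t) (i + 1)
  obtain ⟨θ, hθ⟩ := exists_isHom_map_res f (map_pow_le f a s) (i + 1)
  rw [torMap_eq f M i _ hτ]
  rw [torBaseChange_eq f M i _ hθ] at hx
  exact h s hs hθ hτ x hx

theorem exists_torBaseChange_eq (a : Ideal R) (t : ℕ) : ∃ (s : ℕ) (hst : t ≤ s),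
    ∀ y : TorMod (RingHom.id R') M i (a.map f ^ s), ∃ x : TorMod f M i (a ^ t),
      torBaseChange f M i (map_pow_le f a t) x =
        torMap (RingHom.id R') M i (Ideal.pow_le_pow_right hst) y := by
  obtain ⟨s, hs, h⟩ := exists_mapH_eq_mapH f M a i t
  refine ⟨s, hs, fun y => ?_⟩
  obtain ⟨τ, hτ⟩ := exists_isHom_res (Ideal.pow_le_pow_right hs : a.map f ^ s ≤ a.map f ^ t) (i + 1)
  obtain ⟨θ, hθ⟩ := exists_isHom_map_res f (map_pow_le f a t) (i + 1)
  obtain ⟨x, hx⟩ := h hθ hτ y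
  refine ⟨x, ?_⟩
  rw [torBaseChange_eq f M i _ hθ, torMap_eq (RingHom.id R') M i _ hτ]
  exact hx

end Families

/-! ### Comparison of the inverse limits -/

section Limit

theorem pow_le_pow_of_le {R : Type u} [CommRing R] {a b : Ideal R} (h : a ≤ b) {s t : ℕ}
    (hst : s ≤ t) : a ^ t ≤ b ^ s :=
  (Ideal.pow_right_mono h t).trans (Ideal.pow_le_pow_right hst)

variable {R : Type u} [CommRing R] [IsNoetherianRing R] {R' : Type v} [CommRing R']
  (f : R →+* R') (M : Type w) [AddCommGroup M] [Module R' M] (i : ℕ)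

/-- The inverse limit of the modules `Tor_i^R(R ⧸ a ^ t, M)` for `a ∈ W` and `t ∈ ℕ`. -/
def torLimit (W : Set (Ideal R)) :
    Submodule R' (∀ (a : W) (t : ℕ), TorMod f M i (a.1 ^ t)) where
  carrier := {x | ∀ (a b : W) (h : a.1 ≤ b.1) (s t : ℕ) (hst : s ≤ t),
    torMap f M i (pow_le_pow_of_le h hst) (x a t) = x b s}
  add_mem' {x y} hx hy a b h s t hst := by
    rw [Pi.add_apply, Pi.add_apply, map_add, hx a b h s t hst, hy a b h s t hst]
    rfl
  zero_mem' a b h s t hst := map_zero _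
  smul_mem' r x hx a b h s t hst := by
    rw [Pi.smul_apply, Pi.smul_apply, map_smul, hx a b h s t hst]
    rfl

variable [IsNoetherianRing R'] {I J : Ideal R}

/-- The map from the limit over the ideals of `R` to the limit over the ideals of `R'`. -/
noncomputable def torLimitMap (hJ : f '' (J : Set R) = (J.map f : Set R')) :
    torLimit f M i (idealsOfPair I J) →ₗ[R']
      torLimit (RingHom.id R') M i (idealsOfPair (I.map f) (J.map f)) where
  toFun x := ⟨fun b t => torBaseChange f M i (map_comap_pow_le f b.1 t)
      (x.1 ⟨_, comap_mem_idealsOfPair f hJ b.2⟩ t), fun a b h s t hst => by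
    change _ = torBaseChange f M i _ _
    rw [torMap_torBaseChange, ← x.2 ⟨_, comap_mem_idealsOfPair f hJ a.2⟩
      ⟨_, comap_mem_idealsOfPair f hJ b.2⟩ (Ideal.comap_mono h) s t hst, torBaseChange_torMap]⟩
  map_add' x y := Subtype.ext (funext fun b => funext fun t => map_add _ _ _)
  map_smul' r x := Subtype.ext (funext fun b => funext fun t =>
    (torBaseChange f M i (map_comap_pow_le f b.1 t)).map_smul r _)

/-- The definition evaluates `x` at the contraction of `aR'`, which contains `a`; compatibility of
`x` allows a return to `a`. -/
theorem torLimitMap_map (hJ : f '' (J : Set R) = (J.map f : Set R'))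
    (x : torLimit f M i (idealsOfPair I J)) (a : idealsOfPair I J) (t : ℕ) :
    (torLimitMap f M i hJ x).1 ⟨_, map_mem_idealsOfPair f a.2⟩ t =
      torBaseChange f M i (map_pow_le f a.1 t) (x.1 a t) := by
  change torBaseChange f M i (map_comap_pow_le f (a.1.map f) t) (x.1 ⟨(a.1.map f).comap f,
    comap_mem_idealsOfPair f hJ (map_mem_idealsOfPair f a.2)⟩ t) = _
  rw [← x.2 a ⟨_, comap_mem_idealsOfPair f hJ (map_mem_idealsOfPair f a.2)⟩ Ideal.le_comap_map
    t t le_rfl, torBaseChange_torMap]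

theorem torLimitMap_injective (hJ : f '' (J : Set R) = (J.map f : Set R')) :
    Function.Injective (torLimitMap (I := I) f M i hJ) := by
  rw [injective_iff_map_eq_zero]
  intro x hx
  refine Subtype.ext (funext fun a => funext fun t => ?_)
  obtain ⟨s, hs, h⟩ := exists_torMap_eq_zero f M i a.1 t
  have h1 := h s le_rfl hs (x.1 a s) (by
    rw [← torLimitMap_map f M i hJ, hx]
    rfl)
  exact (x.2 a a le_rfl t s hs).symm.trans h1

/-- Each component of `y` at an extended ideal lifts, since it comes from arbitrarily high exponents
and the cokernels are pro-zero. The lifts need not be compatible, but two of them differ by an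
element of a kernel, which dies under a far enough transition map. The images of the lifts at level
`s₀ a t` are therefore canonical. -/
theorem torLimitMap_surjective (hJ : f '' (J : Set R) = (J.map f : Set R')) :
    Function.Surjective (torLimitMap (I := I) f M i hJ) := by
  intro y
  have hu : ∀ (a : idealsOfPair I J) (t : ℕ), ∃ x : TorMod f M i (a.1 ^ t),
      torBaseChange f M i (map_pow_le f a.1 t) x = y.1 ⟨_, map_mem_idealsOfPair f a.2⟩ t := by
    intro a t
    obtain ⟨s, hs, h⟩ := exists_torBaseChange_eq f M i a.1 t
    obtain ⟨x, hx⟩ := h (y.1 ⟨_, map_mem_idealsOfPair f a.2⟩ s)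
    exact ⟨x, hx.trans (y.2 ⟨_, map_mem_idealsOfPair f a.2⟩ ⟨_, map_mem_idealsOfPair f a.2⟩ le_rfl
      t s hs)⟩
  choose u hu using hu
  choose s₀ hs₀ h₀ using fun (a : idealsOfPair I J) (t : ℕ) => exists_torMap_eq_zero f M i a.1 t
  -- independence of the choices
  have key : ∀ (a : idealsOfPair I J) (t s : ℕ) (hs : s₀ a t ≤ s) (x : TorMod f M i (a.1 ^ s)),
      torBaseChange f M i (map_pow_le f a.1 s) x = y.1 ⟨_, map_mem_idealsOfPair f a.2⟩ s →
        torMap f M i (Ideal.pow_le_pow_right ((hs₀ a t).trans hs)) x =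
          torMap f M i (Ideal.pow_le_pow_right (hs₀ a t)) (u a (s₀ a t)) := by
    intro a t s hs x hx
    have h := h₀ a t _ le_rfl (hs₀ a t)
      (torMap f M i (Ideal.pow_le_pow_right hs) x - u a (s₀ a t)) (by
        rw [map_sub, sub_eq_zero, hu, torBaseChange_torMap,
          ← y.2 ⟨_, map_mem_idealsOfPair f a.2⟩ ⟨_, map_mem_idealsOfPair f a.2⟩ le_rfl _ _ hs, ← hx,
          torMap_torBaseChange])
    rwa [map_sub, sub_eq_zero, torMap_torMap] at h
  refine ⟨⟨fun a t => torMap f M i (Ideal.pow_le_pow_right (hs₀ a t)) (u a (s₀ a t)),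
    fun a b h s t hst => ?_⟩, ?_⟩
  -- Both components can be computed from the common exponent `r`. The image of `u a r` at `b` is a
  -- lift of the corresponding component of `y`, so `key` applies to it there.
  · let r := max (s₀ a t) (s₀ b s)
    have ha : s₀ a t ≤ r := le_max_left _ _
    have hb : s₀ b s ≤ r := le_max_right _ _
    change torMap f M i _ (torMap f M i _ (u a (s₀ a t))) = torMap f M i _ (u b (s₀ b s))
    rw [← key a t r ha (u a r) (hu a r),
      ← key b s r hb (torMap f M i (Ideal.pow_right_mono h r) (u a r)) (by
        rw [torBaseChange_torMap, ← y.2 ⟨_, map_mem_idealsOfPair f a.2⟩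
          ⟨_, map_mem_idealsOfPair f b.2⟩ (Ideal.map_mono h) r r le_rfl, ← hu a r,
          torMap_torBaseChange]),
      torMap_torMap, torMap_torMap]
  -- The component of `y` at `b` is the image of its component at `(b ∩ R)R'`, where the lifts were
  -- chosen.
  · refine Subtype.ext (funext fun b => funext fun t => ?_)
    let a : idealsOfPair I J := ⟨_, comap_mem_idealsOfPair f hJ b.2⟩
    change torBaseChange f M i _ (torMap f M i _ (u a (s₀ a t))) = y.1 b t
    rw [torBaseChange_torMap,
      ← y.2 ⟨_, map_mem_idealsOfPair f a.2⟩ b Ideal.map_comap_le _ _ (hs₀ a t), ← hu a (s₀ a t),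
      torMap_torBaseChange]

/-- Independence of the base ring for the limits of Tor modules. -/
noncomputable def torLimitEquiv (hJ : f '' (J : Set R) = (J.map f : Set R')) :
    torLimit f M i (idealsOfPair I J) ≃ₗ[R']
      torLimit (RingHom.id R') M i (idealsOfPair (I.map f) (J.map f)) :=
  LinearEquiv.ofBijective (torLimitMap f M i hJ)
    ⟨torLimitMap_injective f M i hJ, torLimitMap_surjective f M i hJ⟩

end Limit

end PairLocalHomology

namespace PairLocalHomology

open Matrix

namespace MatCx

/-! ### Matrix resolutions as projective resolutions -/

section ChainComplex

variable {R : Type u} [CommRing R]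

/-- The linear map of free modules given by a matrix. -/
noncomputable def freeMap {m n : Type} [Fintype n] (D : Matrix m n R) :=
  ModuleCat.ofHom D.mulVecLin

theorem freeMap_comp {l m n : Type} [Fintype m] [Fintype n] (D : Matrix l m R) (E : Matrix m n R) :
    freeMap E ≫ freeMap D = freeMap (D * E) := by
  ext v : 2
  exact Matrix.mulVec_mulVec _ _ _

/-- The chain complex of free modules given by the matrices. -/
noncomputable def toChainComplex (C : MatCx R) : ChainComplex (ModuleCat.{u} R) ℕ :=
  ChainComplex.of (fun n => ModuleCat.of R (C.ι n → R))
    (fun n => freeMap (C.d n)) fun n => by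
    rw [freeMap_comp, C.d_mul_d]
    exact ModuleCat.hom_ext (LinearMap.ext fun v => Matrix.zero_mulVec v)

theorem toChainComplex_d (C : MatCx R) (n : ℕ) :
    C.toChainComplex.d (n + 1) n = freeMap (C.d n) :=
  ChainComplex.of_d (V := ModuleCat.{u} R) (fun n => ModuleCat.of R (C.ι n → R))
    (fun n => freeMap (C.d n)) n

/-- The projection from the complex in degree `0` to the quotient by an ideal. -/
def augLin (C : MatCx R) (c : Ideal R) : (C.ι 0 → R) →ₗ[R] R ⧸ c :=
  Submodule.mkQ c ∘ₗ LinearMap.proj C.pt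

theorem augLin_surjective (C : MatCx R) (c : Ideal R) : Function.Surjective (C.augLin c) := by
  intro x
  obtain ⟨r, rfl⟩ := Submodule.Quotient.mk_surjective _ x
  exact ⟨fun _ => r, rfl⟩

/-- The projection from the complex in degree `0` to the quotient by an ideal. -/
noncomputable def augMap (C : MatCx R) (c : Ideal R) :=
  ModuleCat.ofHom (C.augLin c)

theorem d_zero_comp_augMap (C : MatCx R) {c : Ideal R} (hc : C.aug = c) :
    freeMap (C.d 0) ≫ C.augMap c = 0 := by
  subst hc
  exact ModuleCat.hom_ext (LinearMap.ext fun v =>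
    (Submodule.Quotient.mk_eq_zero C.aug).2 (mem_aug.2 ⟨v, rfl⟩))

/-- The augmentation of the chain complex. -/
noncomputable def toSingle (C : MatCx R) {c : Ideal R} (hc : C.aug = c) :=
  (ChainComplex.toSingle₀Equiv C.toChainComplex (ModuleCat.of R (R ⧸ c))).symm ⟨C.augMap c, by
    rw [toChainComplex_d]
    exact C.d_zero_comp_augMap hc⟩

theorem toSingle_f_zero (C : MatCx R) {c : Ideal R} (hc : C.aug = c) :
    (C.toSingle hc).f 0 = C.augMap c :=
  ChainComplex.toSingle₀Equiv_symm_apply_f_zero _ _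

theorem toSingle_apply (C : MatCx R) {c : Ideal R} (hc : C.aug = c) (x : C.ι 0 → R) :
    ((C.toSingle hc).f 0).hom x = C.augLin c x :=
  congrArg (fun F => (ModuleCat.Hom.hom F) x) (C.toSingle_f_zero hc)

/-- The free resolution given by an exact complex of matrices. -/
noncomputable def projectiveResolution (C : MatCx R) (hC : C.Exact) (c : Ideal R) (hc : C.aug = c) :
    ProjectiveResolution (ModuleCat.of R (R ⧸ c)) where
  complex := C.toChainComplex
  projective n := ModuleCat.projective_of_free (Pi.basisFun R (C.ι n))
  π := C.toSingle hc
  quasiIso := ⟨fun n => by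
    cases n with
    | zero =>
      rw [ChainComplex.quasiIsoAt₀_iff, ShortComplex.quasiIso_iff_of_zeros']
      · refine ⟨(ShortComplex.moduleCat_exact_iff _).2 fun x hx => ?_,
          (ModuleCat.epi_iff_surjective _).2 fun x => ?_⟩
        · have hx' : C.augLin c x = 0 := (C.toSingle_apply hc x).symm.trans hx
          subst hc
          obtain ⟨w, hw⟩ := mem_aug.1 ((Submodule.Quotient.mk_eq_zero C.aug).1 hx')
          refine ⟨w, (congrArg (fun F => F.hom w) (C.toChainComplex_d 0)).trans ?_⟩
          exact funext fun i => (C.eq_pt i) ▸ hw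
        · obtain ⟨y, hy⟩ := C.augLin_surjective c x
          exact ⟨y, (C.toSingle_apply hc y).trans hy⟩
      · exact C.toChainComplex.shape _ _ (by simp)
      · rfl
      · rfl
    | succ n =>
      rw [quasiIsoAt_iff_exactAt']
      · rw [HomologicalComplex.exactAt_iff' _ (n + 1 + 1) (n + 1) n (by simp) (by simp)]
        refine (ShortComplex.moduleCat_exact_iff _).2 fun x hx => ?_
        obtain ⟨w, hw⟩ := hC n x
          ((congrArg (fun F => F.hom x) (C.toChainComplex_d n)).symm.trans hx)
        exact ⟨w, (congrArg (fun F => F.hom w) (C.toChainComplex_d (n + 1))).trans hw⟩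
      · apply ChainComplex.exactAt_succ_single_obj⟩

end ChainComplex

/-! ### Categorical homology in terms of matrices -/

section HomologyOfModules

variable {A : Type v} [CommRing A] (K : ChainComplex (ModuleCat.{w} A) ℕ)

theorem iCycles_injective (i : ℕ) : Function.Injective (K.iCycles i).hom :=
  (ModuleCat.mono_iff_injective _).1 inferInstance

theorem homologyπ_surjective (i : ℕ) : Function.Surjective (K.homologyπ i).hom :=
  (ModuleCat.epi_iff_surjective _).1 inferInstance

theorem d_iCycles (i j : ℕ) (z : K.cycles i) : (K.d i j).hom ((K.iCycles i).hom z) = 0 :=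
  congrArg (fun F => (ModuleCat.Hom.hom F) z) (K.iCycles_d i j)

theorem exists_iCycles_eq (i j : ℕ) (hj : (ComplexShape.down ℕ).next i = j) (x : K.X i)
    (hx : (K.d i j).hom x = 0) : ∃ z, (K.iCycles i).hom z = x :=
  (ShortComplex.moduleCat_exact_iff _).1 (ShortComplex.exact_of_f_is_kernel
    (ShortComplex.mk (K.iCycles i) (K.d i j) (K.iCycles_d i j)) (K.cyclesIsKernel i j hj)) x hx

theorem homologyπ_eq_zero_iff (i : ℕ) (z : K.cycles i) : (K.homologyπ i).hom z = 0 ↔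
    ∃ y, (K.d (i + 1) i).hom y = (K.iCycles i).hom z := by
  have h := (ShortComplex.moduleCat_exact_iff _).1 (ShortComplex.exact_of_g_is_cokernel
    (ShortComplex.mk (K.toCycles (i + 1) i) (K.homologyπ i) (K.toCycles_comp_homologyπ _ _))
    (K.homologyIsCokernel (i + 1) i (by simp)))
  have h' : ∀ y, (K.iCycles i).hom ((K.toCycles (i + 1) i).hom y) = (K.d (i + 1) i).hom y :=
    fun y => congrArg (fun F => (ModuleCat.Hom.hom F) y) (K.toCycles_i (i + 1) i)
  constructor
  · intro hz
    obtain ⟨y, rfl⟩ := h z hz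
    exact ⟨y, (h' y).symm⟩
  · rintro ⟨y, hy⟩
    obtain rfl := iCycles_injective K i ((h' y).trans hy)
    exact congrArg (fun F => (ModuleCat.Hom.hom F) y) (K.toCycles_comp_homologyπ (i + 1) i)

variable {R' : Type*} [CommRing R'] {M : Type*} [AddCommGroup M] [Module R' M]
  [Module A M] {C : MatCx R'} (e : ∀ n, K.X n ≃ₗ[A] (C.ι n → M))

theorem map_iCycles_mem_cycles
    (he : ∀ n x, e n ((K.d (n + 1) n).hom x) = act M (C.d n) (e (n + 1) x)) (i : ℕ)
    (z : K.cycles i) :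
    e i ((K.iCycles i).hom z) ∈ cycles M C i := by
  cases i with
  | zero => trivial
  | succ i =>
    change act M (C.d i) _ = 0
    rw [← he, d_iCycles, map_zero]

variable [Algebra A R'] [IsScalarTower A R' M]
  (he : ∀ n x, e n ((K.d (n + 1) n).hom x) = act M (C.d n) (e (n + 1) x))

/-- The class of the vector which corresponds to a cycle of `K`. -/
noncomputable def cyclesToH (i : ℕ) : K.cycles i →ₗ[A] H M C i :=
  (H.mk M C i).restrictScalars A ∘ₗ
    LinearMap.codRestrict ((cycles M C i).restrictScalars A)
      ((e i).toLinearMap ∘ₗ (K.iCycles i).hom) (map_iCycles_mem_cycles K e he i)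

theorem cyclesToH_apply (i : ℕ) (z : K.cycles i) : cyclesToH K e he i z =
    H.mk M C i ⟨e i ((K.iCycles i).hom z), map_iCycles_mem_cycles K e he i z⟩ := rfl

theorem cyclesToH_surjective (i : ℕ) : Function.Surjective (cyclesToH K e he i) := by
  intro x
  obtain ⟨⟨v, hv⟩, rfl⟩ := H.mk_surjective x
  obtain ⟨z, hz⟩ : ∃ z, (K.iCycles i).hom z = (e i).symm v := by
    cases i with
    -- In degree `0` the successor index is `0` itself and the differential is zero, so every
    -- element is a cycle.
    | zero => exact exists_iCycles_eq K 0 0 (by simp) _ (by rw [K.shape _ _ (by simp)]; rfl)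
    | succ i =>
      refine exists_iCycles_eq K (i + 1) i (by simp) _ ((e i).injective ?_)
      rw [he, LinearEquiv.apply_symm_apply, map_zero]
      exact hv
  refine ⟨z, congrArg (H.mk M C i) (Subtype.ext ?_)⟩
  change e i ((K.iCycles i).hom z) = v
  rw [hz, LinearEquiv.apply_symm_apply]

theorem ker_cyclesToH (i : ℕ) :
    LinearMap.ker (cyclesToH K e he i) = LinearMap.ker (K.homologyπ i).hom := by
  ext z
  rw [LinearMap.mem_ker, LinearMap.mem_ker, homologyπ_eq_zero_iff, cyclesToH_apply,
    ← map_zero (H.mk M C i), H.mk_eq_mk_iff]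
  constructor
  · rintro ⟨x, hx⟩
    refine ⟨(e (i + 1)).symm x, (e i).injective ?_⟩
    rw [he, LinearEquiv.apply_symm_apply, hx]
    exact sub_zero _
  · rintro ⟨y, hy⟩
    refine ⟨e (i + 1) y, ?_⟩
    rw [← he, hy]
    exact (sub_zero _).symm

/-- The homology of a complex of modules which is isomorphic to the one given by `C`. -/
noncomputable def homologyEquiv (i : ℕ) : K.homology i ≃ₗ[A] H M C i :=
  ((K.homologyπ i).hom.quotKerEquivOfSurjective (homologyπ_surjective K i)).symm ≪≫ₗ
    Submodule.quotEquivOfEq _ _ (ker_cyclesToH K e he i).symm ≪≫ₗ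
    (cyclesToH K e he i).quotKerEquivOfSurjective (cyclesToH_surjective K e he i)

theorem homologyEquiv_homologyπ (i : ℕ) (z : K.cycles i) :
    homologyEquiv K e he i ((K.homologyπ i).hom z) =
      H.mk M C i ⟨e i ((K.iCycles i).hom z), map_iCycles_mem_cycles K e he i z⟩ := by
  have h : ((K.homologyπ i).hom.quotKerEquivOfSurjective (homologyπ_surjective K i)).symm
      ((K.homologyπ i).hom z) = Submodule.Quotient.mk z := by
    rw [LinearEquiv.symm_apply_eq]
    rfl
  exact congrArg (fun q => (cyclesToH K e he i).quotKerEquivOfSurjective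
    (cyclesToH_surjective K e he i)
      (Submodule.quotEquivOfEq _ _ (ker_cyclesToH K e he i).symm q)) h

theorem homologyEquiv_homologyMap {K' : ChainComplex (ModuleCat.{w} A) ℕ} {C' : MatCx R'}
    (e' : ∀ n, K'.X n ≃ₗ[A] (C'.ι n → M))
    (he' : ∀ n x, e' n ((K'.d (n + 1) n).hom x) = act M (C'.d n) (e' (n + 1) x))
    (φ : K ⟶ K') {G} (i : ℕ) (hG : IsHom (i + 1) C C' G)
    (h : ∀ x, e' i ((φ.f i).hom x) = act M (G i) (e i x)) (x : K.homology i) :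
    homologyEquiv K' e' he' i ((HomologicalComplex.homologyMap φ i).hom x) =
      hG.mapH M (homologyEquiv K e he i x) := by
  obtain ⟨z, rfl⟩ := homologyπ_surjective K i x
  have h1 : (HomologicalComplex.homologyMap φ i).hom ((K.homologyπ i).hom z) =
      (K'.homologyπ i).hom ((HomologicalComplex.cyclesMap φ i).hom z) :=
    congrArg (fun F => (ModuleCat.Hom.hom F) z) (HomologicalComplex.homologyπ_naturality φ i)
  have h2 : (K'.iCycles i).hom ((HomologicalComplex.cyclesMap φ i).hom z) =
      (φ.f i).hom ((K.iCycles i).hom z) :=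
    congrArg (fun F => (ModuleCat.Hom.hom F) z) (HomologicalComplex.cyclesMap_i φ i)
  rw [h1, homologyEquiv_homologyπ, homologyEquiv_homologyπ]
  refine congrArg (H.mk M C' i) (Subtype.ext ?_)
  change e' i _ = act M (G i) (e i _)
  rw [h2, h]

end HomologyOfModules

end MatCx

end PairLocalHomology

namespace PairLocalHomology

open Matrix MatCx

/-! ### Derived-functor Tor and Tor from finite free resolutions -/

section Bridge

variable {R : Type u} [CommRing R]

/-- The matrices of a chain map. -/
noncomputable def chainMapMatrix {C C' : MatCx R} (φ : C.toChainComplex ⟶ C'.toChainComplex)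
    (n : ℕ) : Matrix (C'.ι n) (C.ι n) R :=
  LinearMap.toMatrix' (n := C.ι n) (m := C'.ι n) (φ.f n).hom

theorem chainMapMatrix_mulVecLin {C C' : MatCx R} (φ : C.toChainComplex ⟶ C'.toChainComplex)
    (n : ℕ) : (chainMapMatrix φ n).mulVecLin = (φ.f n).hom :=
  Matrix.toLin'_toMatrix' _

/-- Compatibility with the augmentations, evaluated at the basis vector in degree `0`, says that the
degree `0` entry is congruent to `1`. -/
theorem isHom_chainMapMatrix {C C' : MatCx R} (φ : C.toChainComplex ⟶ C'.toChainComplex)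
    {c c' : Ideal R}    (hc : C.aug = c) (hc' : C'.aug = c') (h : c ≤ c')
    (hφ : ∀ v, C'.augLin c' ((φ.f 0).hom v) = Submodule.mapQ c c' LinearMap.id h (C.augLin c v))
    (N : ℕ) : IsHom N C C' (chainMapMatrix φ) where
  aug_le := by rwa [hc, hc']
  zero := by
    have h1 := hφ (Pi.single C.pt 1)
    rw [← chainMapMatrix_mulVecLin] at h1
    have h2 := (Submodule.Quotient.eq c').1 h1
    subst hc'
    have h3 : (chainMapMatrix φ 0).mulVecLin (Pi.single C.pt 1) C'.pt =
        chainMapMatrix φ 0 C'.pt C.pt := by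
      rw [Matrix.mulVecLin_apply, Matrix.mulVec_single_one]
      rfl
    change (chainMapMatrix φ 0).mulVecLin (Pi.single C.pt 1) C'.pt -
      (Pi.single C.pt 1 : C.ι 0 → R) C.pt ∈ _ at h2
    rwa [h3, Pi.single_eq_same] at h2
  comm n _ := by
    apply Matrix.toLin'.injective
    refine LinearMap.ext fun v => ?_
    have h1 : (C'.toChainComplex.d (n + 1) n).hom ((φ.f (n + 1)).hom v) =
        (φ.f n).hom ((C.toChainComplex.d (n + 1) n).hom v) :=
      congrArg (fun F => (ModuleCat.Hom.hom F) v) (φ.comm (n + 1) n)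
    rw [← chainMapMatrix_mulVecLin, ← chainMapMatrix_mulVecLin, toChainComplex_d,
      toChainComplex_d] at h1
    change (C'.d n * _) *ᵥ v = (_ * C.d n) *ᵥ v
    rw [← Matrix.mulVec_mulVec, ← Matrix.mulVec_mulVec]
    exact h1

variable (R' : Type*) [CommRing R'] [Algebra R R'] (A : Type v) [CommRing A] [Algebra R A]
  (M : Type w) [AddCommGroup M] [Module R M] [Module A M] [Module R' M]
  [IsScalarTower R A M] [IsScalarTower R R' M]

/-- A scalar of `R` acts on `M` through `R'`. Thus tensoring a free complex over `R` with `M` gives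
the complex over `R'`, with coefficients in `M`; the flatness of `R'` plays no role. -/
theorem piScalarRight_lTensor {m n : Type} [Fintype m] [Fintype n] [DecidableEq m] [DecidableEq n]
    (D : Matrix m n R) (x : M ⊗[R] (n → R)) :
    TensorProduct.piScalarRight R A M m
      (TensorProduct.AlgebraTensorModule.lTensor A M D.mulVecLin x) =
      act M (D.map (algebraMap R R')) (TensorProduct.piScalarRight R A M n x) := by
  induction x with
  | zero => simp
  | add x y hx hy => rw [map_add, map_add, map_add, map_add, hx, hy]
  | tmul x v =>
    ext i
    simp [act, Matrix.mulVec, dotProduct, Finset.sum_smul, mul_smul]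

variable {R' A} in
/-- The complex which computes Tor. -/
noncomputable def tensorComplex (C : MatCx R) : ChainComplex (ModuleCat.{max u w} A) ℕ :=
  ((tensorFunctor R A M).mapHomologicalComplex (ComplexShape.down ℕ)).obj C.toChainComplex

/-- The modules of the complex which computes Tor. -/
noncomputable def tensorComplexEquiv (C : MatCx R) (n : ℕ) :
    (tensorComplex (A := A) M C).X n ≃ₗ[A] ((C.map (algebraMap R R')).ι n → M) :=
  TensorProduct.piScalarRight R A M (C.ι n)

theorem tensorComplexEquiv_d (C : MatCx R) (n : ℕ) (x : (tensorComplex (A := A) M C).X (n + 1)) :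
    tensorComplexEquiv R' A M C n (((tensorComplex M C).d (n + 1) n).hom x) =
      act M ((C.map (algebraMap R R')).d n) (tensorComplexEquiv R' A M C (n + 1) x) := by
  have h : ((tensorComplex (A := A) M C).d (n + 1) n).hom x =
      ((tensorFunctor R A M).map (freeMap (C.d n))).hom x :=
    congrArg (fun F => ((tensorFunctor R A M).map F).hom x) (C.toChainComplex_d n)
  exact (congrArg (tensorComplexEquiv R' A M C n) h).trans (piScalarRight_lTensor R' A M (C.d n) x)

variable [IsNoetherianRing R] [Algebra A R'] [IsScalarTower A R' M]

/-- Tor modules, computed from a finite free resolution. -/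
noncomputable def torEquiv (i : ℕ) (c : Ideal R) :
    (torFunctor R A M i).obj (ModuleCat.of R (R ⧸ c)) ≃ₗ[A] TorMod (algebraMap R R') M i c :=
  (((res c).projectiveResolution (res_exact c) c (aug_res c)).isoLeftDerivedObj
    (tensorFunctor R A M) i).toLinearEquiv ≪≫ₗ
  homologyEquiv (tensorComplex M (res c)) (tensorComplexEquiv R' A M (res c))
    (tensorComplexEquiv_d R' A M (res c)) i

theorem torEquiv_map (i : ℕ) {c c' : Ideal R} (h : c ≤ c')
    (x : (torFunctor R A M i).obj (ModuleCat.of R (R ⧸ c))) :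
    torEquiv R' A M i c' (((torFunctor R A M i).map
      (ModuleCat.ofHom (Submodule.mapQ c c' LinearMap.id h))).hom x) =
      torMap (algebraMap R R') M i h (torEquiv R' A M i c x) := by
  let P := (res c).projectiveResolution (res_exact c) c (aug_res c)
  let Q := (res c').projectiveResolution (res_exact c') c' (aug_res c')
  let p := ModuleCat.ofHom (Submodule.mapQ c c' LinearMap.id h)
  -- This lift computes the map on derived functors. Its matrices give an `IsHom`, and `torMap` does
  -- not depend on the choice of such a lift.
  let φ := ProjectiveResolution.lift p P Q
  have hφ : φ.f 0 ≫ Q.π.f 0 = P.π.f 0 ≫ p := ProjectiveResolution.lift_commutes_zero p P Q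
  have hG := isHom_chainMapMatrix (C := res c) (C' := res c') φ (aug_res c) (aug_res c') h
    (fun v => (toSingle_apply _ (aug_res c') _).symm.trans
      ((congrArg (fun F => (ModuleCat.Hom.hom F) v) hφ).trans
        (congrArg (Submodule.mapQ c c' LinearMap.id h) (toSingle_apply _ (aug_res c) v)))) (i + 1)
  rw [torMap_eq _ _ _ _ hG]
  have h1 := ProjectiveResolution.isoLeftDerivedObj_hom_naturality p P Q φ hφ
    (tensorFunctor R A M) i
  have h2 : (Q.isoLeftDerivedObj (tensorFunctor R A M) i).hom.hom
      (((torFunctor R A M i).map p).hom x) =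
    (HomologicalComplex.homologyMap (((tensorFunctor R A M).mapHomologicalComplex _).map φ) i).hom
      ((P.isoLeftDerivedObj (tensorFunctor R A M) i).hom.hom x) :=
    congrArg (fun F => (ModuleCat.Hom.hom F) x) h1
  change homologyEquiv _ _ _ _ ((Q.isoLeftDerivedObj (tensorFunctor R A M) i).hom.hom
    (((torFunctor R A M i).map p).hom x)) = _
  rw [h2]
  refine homologyEquiv_homologyMap (tensorComplex M (res c)) (tensorComplexEquiv R' A M (res c))
    (tensorComplexEquiv_d R' A M (res c)) (tensorComplexEquiv R' A M (res c'))
    (tensorComplexEquiv_d R' A M (res c'))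
    (((tensorFunctor R A M).mapHomologicalComplex _).map φ) i (hG.map _) (fun x => ?_) _
  let G := chainMapMatrix (C := res c) (C' := res c') φ i
  have h3 : ((((tensorFunctor R A M).mapHomologicalComplex (ComplexShape.down ℕ)).map φ).f i).hom x =
      TensorProduct.AlgebraTensorModule.lTensor A M G.mulVecLin x :=
    congrArg (fun F => TensorProduct.AlgebraTensorModule.lTensor A M F x)
      (chainMapMatrix_mulVecLin (C := res c) (C' := res c') φ i).symm
  exact (congrArg (tensorComplexEquiv R' A M (res c') i) h3).trans
    (piScalarRight_lTensor R' A M G x)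

end Bridge

end PairLocalHomology

namespace PairLocalHomology

/-! ### The iterated categorical limit as a module of compatible families -/

section Limit

variable {R : Type u} [CommRing R] (A : Type v) [CommRing A] [Algebra R A]
  (M : Type w) [AddCommGroup M] [Module R M] [Module A M] [IsScalarTower R A M]
  (I J : Ideal R) (i : ℕ)

/-- The projection from the local homology of a pair of ideals to a Tor module. -/
noncomputable def localHomologyPairProj (a : idealsOfPair I J) (t : ℕ) :
    localHomologyPair A M I J i →ₗ[A] (torFunctor R A M i).obj (ModuleCat.of R (R ⧸ a.1 ^ t)) :=
  (limit.π (localHomologySystem A M I J i) a ≫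
    limit.π ((quotPow R).obj a.1 ⋙ torFunctor R A M i) (Opposite.op t)).hom

variable {I J}

theorem localHomologyPair_ext {x y : localHomologyPair A M I J i}
    (h : ∀ a t, localHomologyPairProj A M I J i a t x = localHomologyPairProj A M I J i a t y) :
    x = y := by
  refine Concrete.limit_ext (localHomologySystem A M I J i) x y fun a => ?_
  refine Concrete.limit_ext ((quotPow R).obj a.1 ⋙ torFunctor R A M i) _ _ fun t => ?_
  exact h a t.unop

theorem π_localHomologySystem_map {a b : idealsOfPair I J} (h : a.1 ≤ b.1) (t : ℕ)
    (x : (localHomologySystem A M I J i).obj a) :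
    (limit.π ((quotPow R).obj b.1 ⋙ torFunctor R A M i) (Opposite.op t)).hom
      (((localHomologySystem A M I J i).map (homOfLE (show a ≤ b from h))).hom x) =
      ((torFunctor R A M i).map (ModuleCat.ofHom
        (Submodule.mapQ (a.1 ^ t) (b.1 ^ t) LinearMap.id (Ideal.pow_right_mono h _)))).hom
          ((limit.π ((quotPow R).obj a.1 ⋙ torFunctor R A M i) (Opposite.op t)).hom x) :=
  have h1 : (localHomologySystem A M I J i).map (homOfLE (show a ≤ b from h)) ≫
      limit.π ((quotPow R).obj b.1 ⋙ torFunctor R A M i) (Opposite.op t) =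
        limit.π ((quotPow R).obj a.1 ⋙ torFunctor R A M i) (Opposite.op t) ≫
          (torFunctor R A M i).map (((quotPow R).map (homOfLE h)).app (Opposite.op t)) :=
    limMap_π _ _
  congrArg (fun F => (ModuleCat.Hom.hom F) x) h1

/-- The projection factors through `R ⧸ b ^ t`: the change of ideal is a transition map of the outer
limit, the change of exponent one of the inner limit. -/
theorem map_localHomologyPairProj (a b : idealsOfPair I J) (h : a.1 ≤ b.1) (s t : ℕ) (hst : s ≤ t)
    (x : localHomologyPair A M I J i) :
    ((torFunctor R A M i).map (ModuleCat.ofHom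
      (Submodule.mapQ (a.1 ^ t) (b.1 ^ s) LinearMap.id (pow_le_pow_of_le h hst)))).hom
        (localHomologyPairProj A M I J i a t x) = localHomologyPairProj A M I J i b s x := by
  let y := (limit.π (localHomologySystem A M I J i) a).hom x
  let q := ModuleCat.ofHom
    (Submodule.mapQ (b.1 ^ t) (b.1 ^ s) LinearMap.id (Ideal.pow_le_pow_right hst))
  have h1 : ((localHomologySystem A M I J i).map (homOfLE (show a ≤ b from h))).hom y =
      (limit.π (localHomologySystem A M I J i) b).hom x :=
    congrArg (fun F => (ModuleCat.Hom.hom F) x) (limit.w (localHomologySystem A M I J i) _)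
  have h2 (z) : ((torFunctor R A M i).map q).hom
      ((limit.π ((quotPow R).obj b.1 ⋙ torFunctor R A M i) (Opposite.op t)).hom z) =
        (limit.π ((quotPow R).obj b.1 ⋙ torFunctor R A M i) (Opposite.op s)).hom z :=
    congrArg (fun F => (ModuleCat.Hom.hom F) z)
      (limit.w ((quotPow R).obj b.1 ⋙ torFunctor R A M i) (homOfLE hst).op)
  have h3 : (torFunctor R A M i).map (ModuleCat.ofHom
      (Submodule.mapQ (a.1 ^ t) (b.1 ^ s) LinearMap.id (pow_le_pow_of_le h hst))) =
      (torFunctor R A M i).map (ModuleCat.ofHom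
        (Submodule.mapQ (a.1 ^ t) (b.1 ^ t) LinearMap.id (Ideal.pow_right_mono h _))) ≫
      (torFunctor R A M i).map q := by
    rw [← (torFunctor R A M i).map_comp]
    refine congrArg (torFunctor R A M i).map (ModuleCat.hom_ext (LinearMap.ext fun y => ?_))
    obtain ⟨y, rfl⟩ := Submodule.Quotient.mk_surjective _ y
    rfl
  rw [h3]
  exact (congrArg ((torFunctor R A M i).map q).hom
    (π_localHomologySystem_map A M i h t y).symm).trans ((congrArg _
      (congrArg (limit.π ((quotPow R).obj b.1 ⋙ torFunctor R A M i) (Opposite.op t)).hom h1)).trans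
        (h2 _))

variable [IsNoetherianRing R] (R' : Type*) [CommRing R'] [Algebra R R'] [Module R' M]
  [IsScalarTower R R' M] [Algebra A R'] [IsScalarTower A R' M]

/-- The components of an element of the local homology of a pair of ideals. -/
noncomputable def localHomologyPairToTorLimit : localHomologyPair A M I J i →ₗ[A]
    torLimit (algebraMap R R') M i (idealsOfPair I J) where
  toFun x := ⟨fun a t => torEquiv R' A M i (a.1 ^ t) (localHomologyPairProj A M I J i a t x),
    fun a b h s t hst => by
      rw [← torEquiv_map, map_localHomologyPairProj A M i a b h s t hst]⟩
  map_add' x y := Subtype.ext (funext fun a => funext fun t =>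
    map_add ((torEquiv R' A M i (a.1 ^ t)).toLinearMap ∘ₗ localHomologyPairProj A M I J i a t) x y)
  map_smul' r x := Subtype.ext (funext fun a => funext fun t =>
    ((torEquiv R' A M i (a.1 ^ t)).toLinearMap ∘ₗ localHomologyPairProj A M I J i a t).map_smul r x)

theorem localHomologyPairToTorLimit_injective :
    Function.Injective (localHomologyPairToTorLimit (I := I) (J := J) A M i R') := fun _ _ h =>
  localHomologyPair_ext A M i fun a t => (torEquiv R' A M i (a.1 ^ t)).injective
    (congrFun (congrFun (congrArg Subtype.val h) a) t)

/-- The coordinates of a family of elements of Tor modules, as elements of the derived functors. -/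
noncomputable def torLimitLeg (a : idealsOfPair I J) (t : ℕ) :
    torLimit (algebraMap R R') M i (idealsOfPair I J) →ₗ[A]
      (torFunctor R A M i).obj (ModuleCat.of R (R ⧸ a.1 ^ t)) where
  toFun x := (torEquiv R' A M i (a.1 ^ t)).symm (x.1 a t)
  map_add' x y := map_add (torEquiv R' A M i (a.1 ^ t)).symm (x.1 a t) (y.1 a t)
  map_smul' r x := (torEquiv R' A M i (a.1 ^ t)).symm.map_smul r (x.1 a t)

theorem map_torLimitLeg (a b : idealsOfPair I J) (h : a.1 ≤ b.1) (s t : ℕ) (hst : s ≤ t)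
    (x : torLimit (algebraMap R R') M i (idealsOfPair I J)) :
    ((torFunctor R A M i).map (ModuleCat.ofHom
      (Submodule.mapQ (a.1 ^ t) (b.1 ^ s) LinearMap.id (pow_le_pow_of_le h hst)))).hom
        (torLimitLeg A M i R' a t x) = torLimitLeg A M i R' b s x := by
  apply (torEquiv R' A M i (b.1 ^ s)).injective
  rw [torEquiv_map]
  change torMap (algebraMap R R') M i _ (torEquiv R' A M i _ ((torEquiv R' A M i _).symm _)) =
    torEquiv R' A M i _ ((torEquiv R' A M i _).symm _)
  rw [LinearEquiv.apply_symm_apply, LinearEquiv.apply_symm_apply]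
  exact x.2 a b h s t hst

/-- The families of elements of Tor modules, as a cone over the Tor modules for one ideal. -/
noncomputable def innerCone (a : idealsOfPair I J) :
    Cone ((quotPow R).obj a.1 ⋙ torFunctor R A M i) where
  pt := ModuleCat.of A (torLimit (algebraMap R R') M i (idealsOfPair I J))
  π := { app := fun t => ModuleCat.ofHom (torLimitLeg A M i R' a t.unop)
         naturality := fun _ _ k => ModuleCat.hom_ext (LinearMap.ext fun x =>
          (map_torLimitLeg A M i R' a a le_rfl _ _ (leOfHom k.unop) x).symm) }

theorem π_lift_innerCone (a : idealsOfPair I J) (t : ℕ)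
    (x : torLimit (algebraMap R R') M i (idealsOfPair I J)) :
    (limit.π ((quotPow R).obj a.1 ⋙ torFunctor R A M i) (Opposite.op t)).hom
      ((limit.lift _ (innerCone A M i R' a)).hom x) = torLimitLeg A M i R' a t x :=
  congrArg (fun F => (ModuleCat.Hom.hom F) x)
    (limit.lift_π (innerCone A M i R' a) (Opposite.op t))

/-- The families of elements of Tor modules, as a cone over the inverse system of local homology
modules. -/
noncomputable def outerCone : Cone (localHomologySystem A M I J i) where
  pt := ModuleCat.of A (torLimit (algebraMap R R') M i (idealsOfPair I J))
  π := { app := fun a => limit.lift _ (innerCone A M i R' a)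
         naturality := fun a b k => by
          refine ModuleCat.hom_ext (LinearMap.ext fun x => ?_)
          refine Concrete.limit_ext ((quotPow R).obj b.1 ⋙ torFunctor R A M i) _ _ fun t => ?_
          refine (π_lift_innerCone A M i R' b t.unop x).trans (Eq.symm ?_)
          refine (π_localHomologySystem_map A M i (leOfHom k) t.unop
            ((limit.lift _ (innerCone A M i R' a)).hom x)).trans ?_
          refine (congrArg _ (π_lift_innerCone A M i R' a t.unop x)).trans ?_
          exact map_torLimitLeg A M i R' a b (leOfHom k) _ _ le_rfl x }

theorem localHomologyPairToTorLimit_surjective :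
    Function.Surjective (localHomologyPairToTorLimit (I := I) (J := J) A M i R') := by
  intro x
  refine ⟨(limit.lift _ (outerCone A M i R')).hom x,
    Subtype.ext (funext fun a => funext fun t => ?_)⟩
  change torEquiv R' A M i _ _ = _
  rw [← LinearEquiv.eq_symm_apply]
  have h1 : (limit.π (localHomologySystem A M I J i) a).hom
      ((limit.lift _ (outerCone A M i R')).hom x) = (limit.lift _ (innerCone A M i R' a)).hom x :=
    congrArg (fun F => (ModuleCat.Hom.hom F) x) (limit.lift_π (outerCone A M i R') a)
  exact (congrArg (limit.π ((quotPow R).obj a.1 ⋙ torFunctor R A M i) (Opposite.op t)).hom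
    h1).trans (π_lift_innerCone A M i R' a t x)

/-- The local homology of a pair of ideals in terms of finite free resolutions. -/
noncomputable def localHomologyPairEquiv : localHomologyPair A M I J i ≃ₗ[A]
    torLimit (algebraMap R R') M i (idealsOfPair I J) :=
  LinearEquiv.ofBijective (localHomologyPairToTorLimit A M i R')
    ⟨localHomologyPairToTorLimit_injective A M i R',
      localHomologyPairToTorLimit_surjective A M i R'⟩

end Limit

end PairLocalHomology

namespace PairLocalHomology

/-! ### The completion of a Noetherian local ring is Noetherian -/

section NoetherianCompletion

theorem exists_truncTotal_eq_sum {R : Type u} [CommRing R] {r : ℕ}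
    (h : ℕ → MvPolynomial (Fin r) R)
    (hh : ∀ k, (h k).IsHomogeneous k) :
    ∃ p : MvPowerSeries (Fin r) R, ∀ n, p.truncTotal n = ∑ k ∈ Finset.range n, h k := by
  obtain ⟨p, hp⟩ : ∃ p : MvPowerSeries (Fin r) R, ∀ d, p.coeff d = (h d.degree).coeff d :=
    ⟨fun d => (h d.degree).coeff d, fun _ => rfl⟩
  refine ⟨p, fun n => MvPolynomial.ext _ _ fun d => ?_⟩
  rw [MvPowerSeries.coeff_truncTotal_eq_ite, hp, MvPolynomial.coeff_sum]
  have h0 : ∀ k, k ≠ d.degree → (h k).coeff d = 0 := fun k hk =>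
    (hh k).coeff_eq_zero (Ne.symm hk)
  split_ifs with hd
  · exact (Finset.sum_eq_single_of_mem _ (Finset.mem_range.2 hd) fun k _ hk => h0 k hk).symm
  · exact (Finset.sum_eq_zero fun k hk => h0 k fun e => hd (e ▸ Finset.mem_range.1 hk)).symm

variable {R : Type u} [CommRing R] [IsLocalRing R]

open IsLocalRing

theorem idealOfVars_pow_le_comap {r : ℕ} {x : Fin r → R} (hx : ∀ i, x i ∈ maximalIdeal R) (n : ℕ) :
    MvPolynomial.idealOfVars (Fin r) R ^ n ≤ (maximalIdeal R ^ n).comap (MvPolynomial.eval x) := by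
  refine (Ideal.pow_right_mono (Ideal.map_le_iff_le_comap.1 ?_) n).trans (Ideal.le_comap_pow _ n)
  rw [MvPolynomial.idealOfVars, Ideal.map_span, Ideal.span_le]
  rintro _ ⟨_, ⟨i, rfl⟩, rfl⟩
  simpa using hx i

/-- The evaluation of power series at elements of the maximal ideal, with values modulo a power of
this ideal. -/
noncomputable def evalMod {r : ℕ} {x : Fin r → R} (hx : ∀ i, x i ∈ maximalIdeal R) (n : ℕ) :
    MvPowerSeries (Fin r) R →+* R ⧸ maximalIdeal R ^ n :=
  (Ideal.quotientMap (maximalIdeal R ^ n) (MvPolynomial.eval x)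
    (idealOfVars_pow_le_comap hx n)).comp
    (MvPowerSeries.truncTotalAlgHom (Fin r) R n).toRingHom

theorem evalMod_apply {r : ℕ} {x : Fin r → R} (hx : ∀ i, x i ∈ maximalIdeal R) (n : ℕ)
    (p : MvPowerSeries (Fin r) R) : evalMod hx n p =
      Ideal.Quotient.mk (maximalIdeal R ^ n) (MvPolynomial.eval x (p.truncTotal n)) := rfl

theorem factorPow_evalMod {r : ℕ} {x : Fin r → R} (hx : ∀ i, x i ∈ maximalIdeal R) {m n : ℕ}
    (h : m ≤ n) :
    (Ideal.Quotient.factorPow (maximalIdeal R) h).comp (evalMod hx n) = evalMod hx m := by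
  ext p
  refine Ideal.Quotient.eq.2 ?_
  rw [← map_sub]
  exact idealOfVars_pow_le_comap hx m
    (MvPowerSeries.truncTotal_sub_truncTotal_mem_pow_idealOfVars h le_rfl p)

/-- The evaluation of power series at elements of the maximal ideal. -/
noncomputable def evalCompletion {r : ℕ} {x : Fin r → R} (hx : ∀ i, x i ∈ maximalIdeal R) :
    MvPowerSeries (Fin r) R →+* Completion R :=
  AdicCompletion.liftRingHom (maximalIdeal R) (evalMod hx) fun h => factorPow_evalMod hx h

/-- An element of the completion is a telescoping series of differences `b (k + 1) - b k` in the
`k`-th power of the maximal ideal. Each is a form of degree `k` in the generators, and these forms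
are the homogeneous parts of a power series. -/
theorem evalCompletion_surjective {r : ℕ} {x : Fin r → R} (hx : ∀ i, x i ∈ maximalIdeal R)
    (hspan : Ideal.span (Set.range x) = maximalIdeal R) :
    Function.Surjective (evalCompletion hx) := by
  intro a
  obtain ⟨b, hb0, hb⟩ : ∃ b : ℕ → R, b 0 = 0 ∧
      ∀ n, AdicCompletion.evalₐ (maximalIdeal R) n a = Ideal.Quotient.mk _ (b n) := by
    choose b hb using exists_evalₐ_eq a
    -- The quotient by the zeroth power is trivial, so `b 0 = 0` is permitted; the telescoping sum
    -- then has no initial term.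
    refine ⟨fun n => if n = 0 then 0 else b n, if_pos rfl, fun n => ?_⟩
    cases n with
    | zero =>
      have : Subsingleton (R ⧸ maximalIdeal R ^ 0) := Ideal.Quotient.subsingleton_iff.2 (by simp)
      exact Subsingleton.elim _ _
    | succ n => exact hb _
  have hsub : ∀ k, b (k + 1) - b k ∈ Ideal.span (Set.range x) ^ k := fun k => by
    rw [hspan, ← Ideal.Quotient.eq, ← hb k, evalₐ_eq_of_le a (Nat.le_succ k) _ (hb (k + 1))]
  choose h hh hh' using fun k => (Ideal.mem_span_pow_iff_exists_isHomogeneous x _).1 (hsub k)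
  obtain ⟨p, hp⟩ := exists_truncTotal_eq_sum h hh
  refine ⟨p, AdicCompletion.ext_evalₐ fun n => ?_⟩
  rw [evalCompletion, AdicCompletion.evalₐ_liftRingHom, evalMod_apply, hp, map_sum, hb]
  simp_rw [hh']
  rw [Finset.sum_range_sub, hb0, sub_zero]

theorem isNoetherianRing_completion [IsNoetherianRing R] : IsNoetherianRing (Completion R) := by
  obtain ⟨r, x, hx⟩ := Submodule.fg_iff_exists_fin_generating_family.1
    (IsNoetherian.noetherian (maximalIdeal R))
  have hx' : ∀ i, x i ∈ maximalIdeal R := fun i => hx ▸ Submodule.subset_span ⟨i, rfl⟩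
  exact isNoetherianRing_of_surjective _ _ (evalCompletion hx') (evalCompletion_surjective hx' hx)

end NoetherianCompletion

/-! ### Compatibility of the two actions on an Artinian module -/

section CompletionModule

variable (R : Type u) [CommRing R] [IsLocalRing R] [IsNoetherianRing R]
  (M : Type w) [AddCommGroup M] [Module R M] [IsArtinian R M]

theorem isScalarTower_completion :
    let := completionModule R M
    IsScalarTower R (Completion R) M := by
  let := completionModule R M
  refine IsScalarTower.of_algebraMap_smul fun r x => ?_
  obtain ⟨n, hn⟩ := exists_pow_smul_eq_zero R x
  exact completionSMul_eq _ x n hn r (AlgHom.commutes _ r)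

end CompletionModule

end PairLocalHomology

/-! ### The theorem and the corollary -/

theorem mainTheorem9 {R : Type u} [CommRing R] [IsNoetherianRing R] (I J : Ideal R) :
    (∀ (R' : Type v) [CommRing R'] [IsLocalRing R'] [IsNoetherianRing R'] [Algebra R R']
      (M : Type w) [AddCommGroup M] [Module R M] [Module R' M] [IsScalarTower R R' M]
      [TopologicalSpace M],
      IsLinearlyCompact R' M →
      algebraMap R R' '' (J : Set R) = (J.map (algebraMap R R') : Set R') →
      ∀ i : ℕ, Nonempty
        (PairLocalHomology.localHomologyPair R' M I J i ≃ₗ[R']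
          PairLocalHomology.localHomologyPair R' M
            (I.map (algebraMap R R')) (J.map (algebraMap R R')) i)) ∧
    (∀ [IsLocalRing R] (M : Type w) [AddCommGroup M] [Module R M] [IsArtinian R M],
      algebraMap R (PairLocalHomology.Completion R) '' (J : Set R) =
        (J.map (algebraMap R (PairLocalHomology.Completion R)) :
          Set (PairLocalHomology.Completion R)) →
      letI := PairLocalHomology.completionModule R M
      ∀ i : ℕ, Nonempty
        (PairLocalHomology.localHomologyPair R M I J i ≃ₗ[R]
          (ModuleCat.restrictScalars (algebraMap R (PairLocalHomology.Completion R))).obj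
            (PairLocalHomology.localHomologyPair (PairLocalHomology.Completion R) M
              (I.map (algebraMap R (PairLocalHomology.Completion R)))
              (J.map (algebraMap R (PairLocalHomology.Completion R))) i))) := by
  refine ⟨?_, ?_⟩
  · intro R' _ _ _ _ M _ _ _ _ _ _ hJ i
    exact ⟨PairLocalHomology.localHomologyPairEquiv R' M i R' ≪≫ₗ
      PairLocalHomology.torLimitEquiv (algebraMap R R') M i hJ ≪≫ₗ
      (PairLocalHomology.localHomologyPairEquiv R' M i R').symm⟩
  · intro _ M _ _ _ hJ
    let := PairLocalHomology.completionModule R M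
    intro i
    have : IsScalarTower R (PairLocalHomology.Completion R) M :=
      PairLocalHomology.isScalarTower_completion R M
    have : IsNoetherianRing (PairLocalHomology.Completion R) :=
      PairLocalHomology.isNoetherianRing_completion
    let f := algebraMap R (PairLocalHomology.Completion R)
    let e := PairLocalHomology.localHomologyPairEquiv (I := I.map f) (J := J.map f)
      (PairLocalHomology.Completion R) M i (PairLocalHomology.Completion R)
    -- The inverse of `e` regarded as an `R`-linear map: on the categorical side `R` acts by
    -- restriction of scalars, on the module of families through the scalar tower.
    let e' : PairLocalHomology.torLimit (RingHom.id (PairLocalHomology.Completion R)) M i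
        (PairLocalHomology.idealsOfPair (I.map f) (J.map f)) ≃ₗ[R]
          (ModuleCat.restrictScalars f).obj (PairLocalHomology.localHomologyPair
            (PairLocalHomology.Completion R) M (I.map f) (J.map f) i) :=
      { toFun := e.symm
        invFun := e
        left_inv := e.apply_symm_apply
        right_inv := e.symm_apply_apply
        map_add' := map_add e.symm
        map_smul' := fun r x => (congrArg e.symm (algebraMap_smul _ r x).symm).trans
          (e.symm.map_smul (f r) x) }
    exact ⟨PairLocalHomology.localHomologyPairEquiv R M i (PairLocalHomology.Completion R) ≪≫ₗ
      (PairLocalHomology.torLimitEquiv f M i hJ).restrictScalars R ≪≫ₗ e'⟩
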